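/- For $\lambda\in\mathbb C\setminus\{0\}$ let $G(\lambda)=\mathbb Z[\lambda^{\pm1}]\rtimes\mathbb Z$, where the positive generator of $\mathbb Z$ acts on the additive group of the subring $\mathbb Z[\lambda^{\pm1}]\subset\mathbb C$ by multiplication by $\lambda$. Let $M=F/F''$ be the free metabelian group on two generators $a,b$, with $F$ free on $a,b$. For a Laurent polynomial $P=\sum_{i,j}\beta_{ij}x^iy^j\in L=\mathbb Z[x^{\pm1},y^{\pm1}]$ put $c^P=\prod_{i,j}(a^ib^j)c^{\beta_{ij}}(a^ib^j)^{-1}\in M'$, where $c=[a,b]=aba^{-1}b^{-1}$; for an ideal $\mathfrak a\subset L$ let $M(\mathfrak a)$ be the quotient of $M$ by the normal subgroup generated by $\{c^P:P\in\mathfrak a\}$. Let $P_\lambda(x)\in\mathbb Z[x]$ be the unique irreducible polynomial with positive leading coefficient vanishing at $\lambda$ if $\lambda$ is algebraic, and $P_\lambda=0$ if $\lambda$ is transcendental. Put $M(\lambda)=M\big((\Phi_m(x),\,y-1)\big)$ if $\lambda$ is a primitive $m$-th root of unity, where $\Phi_m$ is the $m$-th cyclotomic polynomial, and $M(\lambda)=M\big((P_\lambda(x))\big)$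 if $\lambda$ is not a root of unity. The universal theory of a group is the set of universal first-order sentences in the language of groups that hold in it. **Theorem.** Let $\lambda\in\mathbb C\setminus\{0,1\}$. 1. Let $G$ be a non-abelian group generated by two elements. Then $G$ has the same universal theory as $G(\lambda)$ if and only if $G$ is isomorphic to $G(\lambda)$ or to $M(\lambda)$. 2. The Krull dimension of $M(\lambda)$ is $1$: the largest integer $k\ge0$ for which there is a chain of surjective, non-injective homomorphisms $M(\lambda)=Q_0\to Q_1\to\dots\to Q_k$, in which every $Q_i$ has the same universal theory as $M(\lambda)$, is $k=1$. -/

import Mathlib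

open Polynomial

noncomputable section

namespace UnivTh

universe u

/-! ### Universal theory of a group -/

/-- Function symbols of the first-order language of groups. -/
inductive GroupFunc : ℕ → Type
  | one : GroupFunc 0
  | inv : GroupFunc 1
  | mul : GroupFunc 2

/-- The first-order language of groups. -/
def groupLang : FirstOrder.Language where
  Functions := GroupFunc
  Relations := fun _ => Empty

/-- A group, seen as a structure for the language of groups. -/
instance groupStructure (G : Type*) [Group G] : groupLang.Structure G where
  funMap := fun {n} (f : GroupFunc n) =>
    match n, f with
    | _, GroupFunc.one => fun _ => 1
    | _, GroupFunc.inv => fun x => (x 0)⁻¹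
    | _, GroupFunc.mul => fun x => x 0 * x 1
  RelMap := fun {_} r _ => r.elim

/-- `Th_∀(G)`: the set of universal sentences of the language of groups that hold in `G`. -/
def universalTheory (G : Type*) [Group G] : Set groupLang.Sentence :=
  {φ | φ.IsUniversal ∧ G ⊨ φ}

/-! ### Two-generated groups and Krull dimension -/

/-- `G` is generated by two (not necessarily distinct) elements. -/
def IsTwoGenerated (G : Type*) [Group G] : Prop :=
  ∃ a b : G, Subgroup.closure {a, b} = ⊤

/-- There is a chain `G = Q₀ → Q₁ → ⋯ → Q_k` of surjective non-injective homomorphisms, in which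
every group has the same universal theory as `G`. -/
def HasQuotientChain (G : Type u) [Group G] (k : ℕ) : Prop :=
  ∃ (Q : Fin (k + 1) → Type u) (_ : ∀ i, Group (Q i))
    (f : ∀ i : Fin k, Q i.castSucc →* Q i.succ),
    Nonempty (Q 0 ≃* G) ∧
    (∀ i, universalTheory (Q i) = universalTheory G) ∧
    ∀ i, Function.Surjective (f i) ∧ ¬ Function.Injective (f i)

/-- The Krull dimension of `G` is the integer `k`: the largest length of a chain of proper
quotients having the same universal theory as `G`. -/
def HasKrullDim (G : Type u) [Group G] (k : ℕ) : Prop :=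
  IsGreatest {k : ℕ | HasQuotientChain G k} k

/-! ### The groups `G(l) = ℤ[l, l⁻¹] ⋊ ℤ` -/

/-- The action of `ℤ` on the additive group of a ring by multiplication by (powers of) a unit. -/
def unitAction {R : Type*} [CommRing R] (u : Rˣ) :
    Multiplicative ℤ →* MulAut (Multiplicative R) :=
  zpowersHom (MulAut (Multiplicative R))
    (AddEquiv.toMultiplicative (DistribMulAction.toAddEquiv R u))

/-- The subring `ℤ[l, l⁻¹]` of `ℂ`. -/
abbrev laurentRing (l : ℂ) : Subalgebra ℤ ℂ := Algebra.adjoin ℤ {l, l⁻¹}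

/-- `l` as a unit of `ℤ[l, l⁻¹]`. -/
def laurentUnit (l : ℂ) (h0 : l ≠ 0) : (laurentRing l)ˣ where
  val := ⟨l, Algebra.subset_adjoin (by simp)⟩
  inv := ⟨l⁻¹, Algebra.subset_adjoin (by simp)⟩
  val_inv := Subtype.ext (mul_inv_cancel₀ h0)
  inv_val := Subtype.ext (inv_mul_cancel₀ h0)

/-- `G(l) = ℤ[l, l⁻¹] ⋊ ℤ`, where the generator of `ℤ` acts by multiplication by `l`. -/
abbrev GGroup (l : ℂ) (h0 : l ≠ 0) : Type :=
  Multiplicative (laurentRing l) ⋊[unitAction (laurentUnit l h0)] Multiplicative ℤ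

/-! ### The groups `M(𝔞)` -/

/-- `ℤ[x^{±1}, y^{±1}]`, as the group ring of `ℤ²`: `(i, j)` is the exponent of `x^i y^j`. -/
abbrev Laurent2 : Type := AddMonoidAlgebra ℤ (ℤ × ℤ)

/-- The variable `x`. -/
def varX : Laurent2 := AddMonoidAlgebra.single (1, 0) 1

/-- The variable `y`. -/
def varY : Laurent2 := AddMonoidAlgebra.single (0, 1) 1

/-- The free metabelian group on two generators, `F / F''`. -/
abbrev FreeMetab2 : Type := FreeGroup (Fin 2) ⧸ derivedSeries (FreeGroup (Fin 2)) 2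

/-- The first generator. -/
def genA : FreeMetab2 := QuotientGroup.mk (FreeGroup.of 0)

/-- The second generator. -/
def genB : FreeMetab2 := QuotientGroup.mk (FreeGroup.of 1)

theorem commutator_comm (g h : commutator FreeMetab2) : g * h = h * g := by
  have hc : commutator FreeMetab2 =
      (commutator (FreeGroup (Fin 2))).map
        (QuotientGroup.mk' (derivedSeries (FreeGroup (Fin 2)) 2)) := by
    rw [commutator_def, commutator_def, Subgroup.map_commutator,
      Subgroup.map_top_of_surjective _ (QuotientGroup.mk'_surjective _)]
  obtain ⟨g, hg⟩ := g
  obtain ⟨h, hh⟩ := h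
  rw [hc] at hg hh
  obtain ⟨u, hu, rfl⟩ := hg
  obtain ⟨v, hv, rfl⟩ := hh
  apply Subtype.ext
  change QuotientGroup.mk' _ u * QuotientGroup.mk' _ v =
    QuotientGroup.mk' _ v * QuotientGroup.mk' _ u
  rw [← commutatorElement_eq_one_iff_mul_comm, ← map_commutatorElement,
    QuotientGroup.mk'_apply, QuotientGroup.eq_one_iff]
  rw [derivedSeries_succ, derivedSeries_one]
  exact Subgroup.commutator_mem_commutator hu hv

instance : CommGroup (commutator FreeMetab2) where
  mul_comm := commutator_comm

/-- The commutator `c = [a, b]`. -/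
def commC : commutator FreeMetab2 :=
  ⟨genA * genB * genA⁻¹ * genB⁻¹,
    Subgroup.commutator_mem_commutator (Subgroup.mem_top _) (Subgroup.mem_top _)⟩

/-- `c^P = ∏_{i,j} (a^i b^j) c^{β_{ij}} (a^i b^j)⁻¹` for `P = ∑_{i,j} β_{ij} x^i y^j`; this is the
identification of `ℤ[x^{±1}, y^{±1}]` with the derived subgroup of the free metabelian group. -/
def commPow (P : Laurent2) : commutator FreeMetab2 :=
  P.coeff.prod fun e n => MulAut.conjNormal (genA ^ e.1 * genB ^ e.2) (commC ^ n)

/-- The normal subgroup of the free metabelian group that corresponds to an ideal `𝔞`. -/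
def idealSubgroup (I : Ideal Laurent2) : Subgroup FreeMetab2 :=
  Subgroup.normalClosure {g | ∃ P ∈ I, g = commPow P}

instance (I : Ideal Laurent2) : (idealSubgroup I).Normal := Subgroup.normalClosure_normal

/-- `M(𝔞)`, the quotient of the free metabelian group on two generators by the ideal `𝔞`. -/
abbrev MIdeal (I : Ideal Laurent2) : Type := FreeMetab2 ⧸ idealSubgroup I

/-! ### The minimal polynomial over `ℤ` and the group `M(l)` -/

/-- `P` is irreducible over `ℤ`, vanishes at `l` and has positive leading coefficient. -/
def IsIntMinpoly (l : ℂ) (P : ℤ[X]) : Prop :=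
  Irreducible P ∧ aeval l P = 0 ∧ 0 < P.leadingCoeff

theorem existsUnique_intMinpoly (l : ℂ) (h : IsAlgebraic ℤ l) : ∃! P, IsIntMinpoly l P := by
  have key : ∀ P : ℤ[X], P ≠ 0 → aeval l P = 0 → ∃ Q : ℤ[X], Irreducible Q ∧ aeval l Q = 0 := by
    intro P
    induction P using WfDvdMonoid.induction_on_irreducible with
    | zero => intro h; exact absurd rfl h
    | unit u hu =>
      intro _ h0
      exact absurd h0 (hu.map (aeval l)).ne_zero
    | mul a i ha hi ih =>
      intro _ h0
      rw [map_mul, mul_eq_zero] at h0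
      rcases h0 with h0 | h0
      · exact ⟨i, hi, h0⟩
      · exact ih ha h0
  obtain ⟨P, hP0, hP⟩ := h
  obtain ⟨Q, hQ, hQ0⟩ := key P hP0 hP
  have hdeg : ∀ Q : ℤ[X], Q ≠ 0 → aeval l Q = 0 → Q.natDegree ≠ 0 := by
    intro Q hQ hQ0 hd
    rw [eq_C_of_natDegree_eq_zero hd] at hQ0 hQ
    rw [aeval_C, algebraMap_int_eq, eq_intCast, Int.cast_eq_zero] at hQ0
    exact hQ (by rw [hQ0, C_0])
  have hdvd : ∀ Q R : ℤ[X], Irreducible Q → aeval l Q = 0 → Irreducible R → aeval l R = 0 →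
      Q ∣ R := by
    intro Q R hQ hQ0 hR hR0
    have hQp := hQ.isPrimitive (hdeg Q hQ.ne_zero hQ0)
    refine (IsPrimitive.Int.dvd_iff_map_cast_dvd_map_cast Q R hQp).2 ?_
    have hQi := (IsPrimitive.Int.irreducible_iff_irreducible_map_cast hQp).1 hQ
    have e : ∀ S : ℤ[X], aeval l (S.map (Int.castRingHom ℚ)) = aeval l S := by
      intro S
      exact aeval_map_algebraMap ℚ l S
    have h1 : minpoly ℚ l ∣ Q.map (Int.castRingHom ℚ) := minpoly.dvd _ _ (by rw [e, hQ0])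
    have h2 : minpoly ℚ l ∣ R.map (Int.castRingHom ℚ) := minpoly.dvd _ _ (by rw [e, hR0])
    exact ((hQi.dvd_iff.1 h1).resolve_left (minpoly.not_isUnit ℚ l)).dvd.trans h2
  have huniq : ∀ Q R : ℤ[X], IsIntMinpoly l Q → IsIntMinpoly l R → Q = R := by
    rintro Q R ⟨hQ, hQ0, hQl⟩ ⟨hR, hR0, hRl⟩
    obtain ⟨u, hu⟩ := associated_of_dvd_dvd (hdvd Q R hQ hQ0 hR hR0) (hdvd R Q hR hR0 hQ hQ0)
    obtain ⟨n, hn, hnu⟩ := Polynomial.isUnit_iff.1 u.isUnit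
    rw [← hnu] at hu
    rcases Int.isUnit_iff.1 hn with rfl | rfl
    · simpa using hu
    · rw [← hu] at hRl
      simp at hRl
      omega
  rcases lt_or_gt_of_ne (leadingCoeff_ne_zero.2 hQ.ne_zero) with hl | hl
  · have : IsIntMinpoly l (-Q) := ⟨(Associated.refl Q).neg_right.irreducible hQ, by simp [hQ0], by simpa using hl⟩
    exact ⟨-Q, this, fun R hR => huniq R _ hR this⟩
  · have : IsIntMinpoly l Q := ⟨hQ, hQ0, hl⟩
    exact ⟨Q, this, fun R hR => huniq R _ hR this⟩

open Classical in
/-- The minimal polynomial `P_l` of `l` over `ℤ`: the unique irreducible integer polynomial with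
positive leading coefficient vanishing at `l` if `l` is algebraic, and `0` if `l` is
transcendental. -/
def intMinpoly (l : ℂ) : ℤ[X] :=
  if h : IsAlgebraic ℤ l then (existsUnique_intMinpoly l h).choose else 0

open Classical in
/-- The ideal that defines `M(l)`: `(Φ_m(x), y - 1)` if `l` is a root of unity of order `m`, and
`(P_l(x))` otherwise. -/
def idealOf (l : ℂ) : Ideal Laurent2 :=
  if IsOfFinOrder l then Ideal.span {aeval varX (cyclotomic (orderOf l) ℤ), varY - 1}
  else Ideal.span {aeval varX (intMinpoly l)}

/-- The group `M(l)`. -/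
abbrev MGroup (l : ℂ) : Type := MIdeal (idealOf l)

end UnivTh

end

open Polynomial

noncomputable section

namespace UnivTh

universe u

open FirstOrder Filter
open scoped commutatorElement

/-! ### Universal theories and finite systems of equations and inequations -/

/-! An inclusion of universal theories says that finite systems of equations and inequations
solvable in one group are solvable in the other. So a two-generated group `G` with the theory of
`G(l)` is a limit, along an ultrafilter, of homomorphisms `ψ n` from the free group to `G(l)`. Since
`G(l)` is metabelian, these factor through the free metabelian group.

A homomorphism to `G(l)` with non-abelian image is controlled by the `t`-exponents `p`, `q` of the
images of `a`, `b`: it multiplies the image of `c` by `P(l^p, l^q)` when `c` is replaced by `c^P`.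
If `l^p ≠ 1`, its kernel depends on `p`, `q` alone (`hom_eq_one_iff`), so the limit depends only on
how the pairs `(p, q)` behave along the ultrafilter. The opposite inclusion of theories provides one
element `u` that eventually acts by a conjugate of `l` (`exists_actsConj`).

If `l` is algebraic and not a root of unity, only `l` and possibly `l⁻¹` are powers of `l` conjugate
to `l`. After an automorphism `p = 1`; then either `q` is eventually constant and the limit is
`G(l)`, or a Laurent polynomial killed in the limit vanishes at `(l, l^q)` for infinitely many `q`,
and the limit is `M(l)`. If `l` is a root of unity or transcendental, what matters is whether the
exponents eventually satisfy a fixed linear relation: if so the limit is `G(l)`, otherwise `M(l)`.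

Conversely `G(l)` embeds in `M(l)`, and the epimorphisms `phiM z` exhibit `M(l)` as a limit of
`G(l)` (`universalTheory_MGroup`). For the dimension, `phiM 0` is a proper quotient map from `M(l)`
to `G(l)`. The classification leaves only these two groups as terms of a chain, and two-generated
metabelian groups are Hopfian, so no chain is longer. -/

/-- The term in two variables that corresponds to a word. -/
def wordTerm : List (Fin 2 × Bool) → groupLang.Term (Empty ⊕ Fin 2)
  | [] => Language.Term.func (L := groupLang) (l := 0) GroupFunc.one Fin.elim0
  | (i, true) :: w => Language.Term.func (L := groupLang) (l := 2) GroupFunc.mul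
      ![Language.Term.var (Sum.inr i), wordTerm w]
  | (i, false) :: w => Language.Term.func (L := groupLang) (l := 2) GroupFunc.mul
      ![Language.Term.func (L := groupLang) (l := 1) GroupFunc.inv
          ![Language.Term.var (Sum.inr i)], wordTerm w]

theorem realize_wordTerm {G : Type*} [Group G] (v : Empty → G) (x : Fin 2 → G)
    (w : List (Fin 2 × Bool)) :
    (wordTerm w).realize (Sum.elim v x) = FreeGroup.lift x (FreeGroup.mk w) := by
  induction w with
  | nil => rfl
  | cons e w ih =>
    obtain ⟨i, b⟩ := e
    have hmk : FreeGroup.mk ((i, b) :: w) = FreeGroup.mk [(i, b)] * FreeGroup.mk w := by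
      rw [FreeGroup.mul_mk]; rfl
    rw [hmk, map_mul, ← ih]
    cases b
    · have h1 : FreeGroup.lift x (FreeGroup.mk [(i, false)]) = (x i)⁻¹ := by simp
      rw [h1]; rfl
    · have h1 : FreeGroup.lift x (FreeGroup.mk [(i, true)]) = x i := by simp
      rw [h1]; rfl

/-- The equation `w = 1` in two variables. -/
def wordEq (w : FreeGroup (Fin 2)) : groupLang.BoundedFormula Empty 2 :=
  (wordTerm w.toWord).bdEqual (wordTerm [])

theorem realize_wordEq {G : Type*} [Group G] (v : Empty → G) (x : Fin 2 → G)
    (w : FreeGroup (Fin 2)) :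
    (wordEq w).Realize v x ↔ FreeGroup.lift x w = 1 := by
  rw [wordEq, Language.BoundedFormula.realize_bdEqual, realize_wordTerm, realize_wordTerm,
    FreeGroup.mk_toWord]
  simp [← FreeGroup.one_eq_mk]

open Classical in
/-- The conjunction of the equations or inequations `w = 1`, for `w ∈ S`, according to whether
`w ∈ K`. -/
def systemFormula (S : Finset (FreeGroup (Fin 2))) (K : Set (FreeGroup (Fin 2))) :
    groupLang.BoundedFormula Empty 2 :=
  (S.toList.map fun w => if w ∈ K then wordEq w else (wordEq w).not).foldr (· ⊓ ·) ⊤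

theorem isQF_systemFormula (S : Finset (FreeGroup (Fin 2))) (K : Set (FreeGroup (Fin 2))) :
    (systemFormula S K).IsQF := by
  classical
  unfold systemFormula
  induction S.toList with
  | nil => exact Language.BoundedFormula.IsQF.top
  | cons w l ih =>
    refine Language.BoundedFormula.IsQF.inf ?_ ih
    have h : (wordEq w).IsQF :=
      (Language.BoundedFormula.IsAtomic.equal _ _).isQF
    dsimp only
    split_ifs
    · exact h
    · exact h.not

theorem realize_systemFormula {G : Type*} [Group G] (v : Empty → G) (x : Fin 2 → G)
    (S : Finset (FreeGroup (Fin 2))) (K : Set (FreeGroup (Fin 2))) :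
    (systemFormula S K).Realize v x ↔ ∀ w ∈ S, (FreeGroup.lift x w = 1 ↔ w ∈ K) := by
  classical
  unfold systemFormula
  rw [Language.BoundedFormula.realize_foldr_inf]
  simp only [List.mem_map, Finset.mem_toList, forall_exists_index, and_imp,
    forall_apply_eq_imp_iff₂]
  refine forall₂_congr fun w _ => ?_
  split_ifs with h
  · simp [realize_wordEq, h]
  · simp [realize_wordEq, h]

/-! ### Inclusions of universal theories as approximation by homomorphisms -/

/-- If no such `ψ` existed, the universal sentence "no pair solves the system" would hold in `A`,
hence in `B`, where `ρ` gives a solution. -/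
theorem exists_hom_of_universalTheory_subset {A B : Type*} [Group A] [Group B]
    (h : universalTheory A ⊆ universalTheory B) (ρ : FreeGroup (Fin 2) →* B)
    (S : Finset (FreeGroup (Fin 2))) :
    ∃ ψ : FreeGroup (Fin 2) →* A, ∀ w ∈ S, (ψ w = 1 ↔ ρ w = 1) := by
  by_contra hcon
  let φ : groupLang.Sentence := (systemFormula S {w | ρ w = 1}).not.all.all
  have hU : φ.IsUniversal :=
    ((Language.BoundedFormula.IsQF.isUniversal (isQF_systemFormula S _).not).all).all
  have hA : A ⊨ φ := by
    intro x y
    rw [Language.BoundedFormula.realize_not]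
    intro hr
    rw [realize_systemFormula] at hr
    exact hcon ⟨_, hr⟩
  have hB : B ⊨ φ := (h ⟨hU, hA⟩).2
  have hx := hB (ρ (FreeGroup.of 0)) (ρ (FreeGroup.of 1))
  rw [Language.BoundedFormula.realize_not, realize_systemFormula] at hx
  refine hx fun w _ => ?_
  have : FreeGroup.lift (Fin.snoc (Fin.snoc default (ρ (FreeGroup.of 0))) (ρ (FreeGroup.of 1)) :
      Fin 2 → B) = ρ := by
    ext i
    fin_cases i <;> simp [Fin.snoc]
  rw [this]; rfl

theorem exists_limit_of_universalTheory_subset {A B : Type*} [Group A] [Group B]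
    (h : universalTheory A ⊆ universalTheory B) (ρ : FreeGroup (Fin 2) →* B) :
    ∃ (U : Ultrafilter (Finset (FreeGroup (Fin 2))))
      (ψ : Finset (FreeGroup (Fin 2)) → FreeGroup (Fin 2) →* A),
      ∀ w, (ρ w = 1 ↔ ∀ᶠ n in (U : Filter _), ψ n w = 1) := by
  choose ψ hψ using exists_hom_of_universalTheory_subset h ρ
  -- Finite sets of words are directed by inclusion, so along an ultrafilter finer than `atTop` each
  -- word is eventually taken into account.
  refine ⟨Ultrafilter.of atTop, ψ, fun w => ?_⟩
  have hev : ∀ᶠ n in (Ultrafilter.of (atTop : Filter (Finset (FreeGroup (Fin 2)))) : Filter _),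
      (ψ n w = 1 ↔ ρ w = 1) := by
    refine Ultrafilter.of_le _ ?_
    filter_upwards [eventually_ge_atTop ({w} : Finset (FreeGroup (Fin 2)))] with S hS
    exact hψ S w (hS (Finset.mem_singleton_self w))
  constructor
  · intro h1
    filter_upwards [hev] with n hn using hn.2 h1
  · intro h1
    obtain ⟨n, hn, hn'⟩ := (hev.and h1).exists
    exact hn.1 hn'

/-- The hypothesis makes `g ↦ (φ n g)` an embedding of `B` into an ultrapower of `A`. By Łoś's
theorem the ultrapower satisfies the theory of `A`, and universal sentences pass to substructures.
-/
theorem universalTheory_subset_of_limit {A B ι : Type*} [Group A] [Group B] (U : Ultrafilter ι)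
    (φ : ι → B →* A) (hφ : ∀ g, g ≠ 1 → ∀ᶠ n in (U : Filter ι), φ n g ≠ 1) :
    universalTheory A ⊆ universalTheory B := by
  rintro θ ⟨hU, hA⟩
  refine ⟨hU, ?_⟩
  have hprod : (U : Filter ι).Product (fun _ => A) ⊨ θ :=
    (Language.Ultraproduct.sentence_realize θ).2 (Eventually.of_forall fun _ => hA)
  let f : B ↪[groupLang] (U : Filter ι).Product (fun _ => A) :=
    { toFun := fun g => ((fun n => φ n g : ∀ _ : ι, A) : (U : Filter ι).Product (fun _ => A))
      inj' := by
        intro g g' hgg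
        have h1 : ∀ᶠ n in (U : Filter ι), φ n g = φ n g' := Quotient.exact hgg
        by_contra hne
        obtain ⟨n, h2, h3⟩ := ((hφ (g * g'⁻¹) (by rwa [Ne, mul_inv_eq_one])).and h1).exists
        exact h2 (by rw [map_mul, map_inv, h3, mul_inv_cancel])
      map_fun' := by
        intro n f x
        refine Eq.trans ?_ (Language.Ultraproduct.funMap_cast f (fun i n => φ n (x i))).symm
        refine congrArg (Quotient.mk ((U : Filter ι).productSetoid fun _ => A)) (funext fun k => ?_)
        cases f with
        | one => exact map_one (φ k)
        | inv => exact map_inv (φ k) _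
        | mul => exact map_mul (φ k) _ _
      map_rel' := fun r => r.elim }
  have := hU.realize_embedding f (v := default) (xs := default)
  apply this
  convert hprod using 1
  simp only [Language.Sentence.Realize, Language.Formula.Realize]
  congr! 1

theorem universalTheory_subset_of_injective {A B : Type*} [Group A] [Group B] (φ : B →* A)
    (hφ : Function.Injective φ) : universalTheory A ⊆ universalTheory B :=
  universalTheory_subset_of_limit (pure () : Ultrafilter Unit) (fun _ => φ) fun g hg =>
    Eventually.of_forall fun _ => by rwa [Ne, map_eq_one_iff φ hφ]

theorem universalTheory_congr {A B : Type*} [Group A] [Group B] (e : A ≃* B) :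
    universalTheory A = universalTheory B :=
  (universalTheory_subset_of_injective e.symm.toMonoidHom e.symm.injective).antisymm
    (universalTheory_subset_of_injective e.toMonoidHom e.injective)

/-! ### Coordinates in the groups `G(l)` -/

theorem unitAction_apply {R : Type*} [CommRing R] (u : Rˣ) (k : Multiplicative ℤ)
    (r : Multiplicative R) :
    unitAction u k r = Multiplicative.ofAdd (((u ^ k.toAdd : Rˣ) : R) * r.toAdd) := by
  have h : ∀ (k : ℤ) (r : R), ((AddEquiv.toMultiplicative (DistribMulAction.toAddEquiv R u) :
      MulAut (Multiplicative R)) ^ k) (Multiplicative.ofAdd r) =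
      Multiplicative.ofAdd (((u ^ k : Rˣ) : R) * r) := by
    intro k
    induction k with
    | zero => intro r; simp
    | succ n ih =>
      intro r
      rw [zpow_add_one, zpow_add_one, MulAut.mul_apply]
      erw [ih (u * r)]
      simp [mul_assoc]
    | pred n ih =>
      intro r
      rw [zpow_sub_one, zpow_sub_one, MulAut.mul_apply]
      have h1 : ((AddEquiv.toMultiplicative (DistribMulAction.toAddEquiv R u) :
          MulAut (Multiplicative R))⁻¹) (Multiplicative.ofAdd r) =
          Multiplicative.ofAdd (((u⁻¹ : Rˣ) : R) * r) := by
        rw [MulAut.inv_apply, MulEquiv.symm_apply_eq]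
        change _ = Multiplicative.ofAdd ((u : R) * (((u⁻¹ : Rˣ) : R) * r))
        rw [← mul_assoc, Units.mul_inv, one_mul]
      rw [h1, ih]
      simp [mul_assoc]
  exact h k.toAdd r.toAdd

section Coordinates

variable {l : ℂ} {h0 : l ≠ 0}

/-- The component in `ℤ[l, l⁻¹]` of an element of `G(l)`, as a complex number. -/
def lc (g : GGroup l h0) : ℂ := ((g.left.toAdd : laurentRing l) : ℂ)

/-- The component in `ℤ` of an element of `G(l)`. -/
def tx (g : GGroup l h0) : ℤ := g.right.toAdd

theorem coe_laurentUnit_zpow (k : ℤ) :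
    ((((laurentUnit l h0) ^ k : (laurentRing l)ˣ) : laurentRing l) : ℂ) = l ^ k := by
  have h := map_zpow (Units.map ((laurentRing l).val : laurentRing l →* ℂ)) (laurentUnit l h0) k
  have h2 := congrArg Units.val h
  simp only [Units.coe_map, Units.val_zpow_eq_zpow_val] at h2
  exact h2

theorem lc_mul (g h : GGroup l h0) : lc (g * h) = lc g + l ^ tx g * lc h := by
  unfold lc tx
  rw [SemidirectProduct.mul_left, unitAction_apply, toAdd_mul, toAdd_ofAdd]
  push_cast
  rw [coe_laurentUnit_zpow]

theorem tx_mul (g h : GGroup l h0) : tx (g * h) = tx g + tx h := rfl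

@[simp] theorem lc_one : lc (1 : GGroup l h0) = 0 := rfl

@[simp] theorem tx_one : tx (1 : GGroup l h0) = 0 := rfl

theorem ext_lc_tx {g h : GGroup l h0} (h1 : lc g = lc h) (h2 : tx g = tx h) : g = h :=
  SemidirectProduct.ext (Subtype.ext h1) h2

theorem eq_one_iff_lc_tx {g : GGroup l h0} : g = 1 ↔ lc g = 0 ∧ tx g = 0 :=
  ⟨fun h => by simp [h], fun h => ext_lc_tx h.1 h.2⟩

theorem tx_inv (g : GGroup l h0) : tx g⁻¹ = - tx g := rfl

theorem lc_inv (g : GGroup l h0) : lc g⁻¹ = - (l ^ (-tx g) * lc g) := by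
  have h := lc_mul g⁻¹ g
  rw [inv_mul_cancel, lc_one, tx_inv] at h
  linear_combination -h

/-- The projection of `G(l)` to `ℤ`. -/
def txHom : GGroup l h0 →* Multiplicative ℤ := SemidirectProduct.rightHom

theorem tx_zpow (g : GGroup l h0) (k : ℤ) : tx (g ^ k) = k * tx g := by
  refine (congrArg Multiplicative.toAdd (map_zpow (txHom (l := l) (h0 := h0)) g k)).trans ?_
  rw [toAdd_zpow, smul_eq_mul]; rfl

theorem lc_conj (g h : GGroup l h0) (hh : tx h = 0) : lc (g * h * g⁻¹) = l ^ tx g * lc h := by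
  rw [lc_mul, lc_mul, lc_inv, tx_mul, hh, add_zero]
  have : l ^ tx g * l ^ (-tx g) = 1 := by rw [← zpow_add₀ h0]; simp
  linear_combination (-lc g) * this

theorem tx_commutator (g h : GGroup l h0) : tx ⁅g, h⁆ = 0 := by
  rw [commutatorElement_def, tx_mul, tx_mul, tx_mul, tx_inv, tx_inv]; ring

theorem lc_commutator (g h : GGroup l h0) :
    lc ⁅g, h⁆ = (l ^ tx g - 1) * lc h - (l ^ tx h - 1) * lc g := by
  have e : ⁅g, h⁆ = g * h * (h * g)⁻¹ := by rw [commutatorElement_def]; group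
  rw [e, lc_mul, lc_inv, lc_mul, lc_mul, tx_mul, tx_mul]
  have : l ^ (tx g + tx h) * l ^ (-(tx h + tx g)) = 1 := by rw [← zpow_add₀ h0, add_comm (tx h), add_neg_cancel, zpow_zero]
  linear_combination (-(lc h + l ^ tx h * lc g)) * this

theorem derivedSeries_GGroup : derivedSeries (GGroup l h0) 2 = ⊥ := by
  have h1 : derivedSeries (GGroup l h0) 1 ≤ (txHom (l := l) (h0 := h0)).ker := by
    rw [derivedSeries_one]
    exact Abelianization.commutator_subset_ker _
  rw [derivedSeries_succ, eq_bot_iff, Subgroup.commutator_le]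
  intro g hg h hh
  have hg' : tx g = 0 := h1 hg
  have hh' : tx h = 0 := h1 hh
  rw [Subgroup.mem_bot, eq_one_iff_lc_tx, lc_commutator, hg', hh', tx_commutator]
  simp only [zpow_zero, sub_self, zero_mul, and_self]

/-- The generator of `ℤ` in `G(l)`. -/
def genT (l : ℂ) (h0 : l ≠ 0) : GGroup l h0 := SemidirectProduct.inr (Multiplicative.ofAdd 1)

/-- The element `1` of `ℤ[l, l⁻¹]`, seen in `G(l)`. -/
def genE (l : ℂ) (h0 : l ≠ 0) : GGroup l h0 := SemidirectProduct.inl (Multiplicative.ofAdd 1)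

@[simp] theorem lc_genT : lc (genT l h0) = 0 := rfl
@[simp] theorem tx_genT : tx (genT l h0) = 1 := rfl
@[simp] theorem lc_genE : lc (genE l h0) = 1 := rfl
@[simp] theorem tx_genE : tx (genE l h0) = 0 := rfl

theorem closure_genT_genE : Subgroup.closure {genT l h0, genE l h0} = ⊤ := by
  set K := Subgroup.closure {genT l h0, genE l h0} with hK
  have hT : genT l h0 ∈ K := Subgroup.subset_closure (by simp)
  have hE : genE l h0 ∈ K := Subgroup.subset_closure (by simp)
  let A : laurentRing l → GGroup l h0 := fun r => SemidirectProduct.inl (Multiplicative.ofAdd r)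
  have hA : ∀ r, lc (A r) = r := fun r => rfl
  have hA' : ∀ r, tx (A r) = 0 := fun r => rfl
  have hconj : ∀ (k : ℤ) (r s : laurentRing l), A r ∈ K → (s : ℂ) = l ^ k * r → A s ∈ K := by
    intro k r s hr hs
    have : A s = genT l h0 ^ k * A r * (genT l h0 ^ k)⁻¹ := by
      refine ext_lc_tx ?_ ?_
      · rw [lc_conj _ _ (hA' r), tx_zpow, hA, hA, hs]; simp
      · simp [tx_mul, tx_inv, hA']
    rw [this]
    exact K.mul_mem (K.mul_mem (K.zpow_mem hT k) hr) (K.inv_mem (K.zpow_mem hT k))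
  -- The induction is on the multiplier `z` with `r` arbitrary, so that products are handled by
  -- applying the hypothesis twice.
  have hall : ∀ (z : ℂ) (hz : z ∈ laurentRing l) (r : laurentRing l), A r ∈ K →
      A (⟨z, hz⟩ * r) ∈ K := by
    intro z hz
    induction hz using Algebra.adjoin_induction with
    | mem z hz =>
      intro r hr
      rcases hz with rfl | rfl
      · exact hconj 1 r _ hr (by simp)
      · exact hconj (-1) r _ hr (by simp)
    | algebraMap n =>
      intro r hr
      have : A ((algebraMap ℤ (laurentRing l) n) * r) = A r ^ n := by
        refine ext_lc_tx ?_ ?_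
        · have h1 : A r ^ n = SemidirectProduct.inl (Multiplicative.ofAdd (n • r)) := by
            rw [ofAdd_zsmul, map_zpow]
          rw [h1, hA]
          change _ = ((n • r : laurentRing l) : ℂ)
          simp
        · rw [tx_zpow, hA', hA', mul_zero]
      have h2 := K.zpow_mem hr n
      rw [← this] at h2
      exact h2
    | add x y hx hy ihx ihy =>
      intro r hr
      have h := K.mul_mem (ihx r hr) (ihy r hr)
      rw [← map_mul, ← ofAdd_add, ← add_mul] at h
      exact h
    | mul x y hx hy ihx ihy =>
      intro r hr
      have h := ihx _ (ihy r hr)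
      rw [← mul_assoc] at h
      exact h
  rw [eq_top_iff]
  intro g _
  have hg : g = A g.left.toAdd * genT l h0 ^ tx g := by
    refine ext_lc_tx ?_ ?_
    · rw [lc_mul, hA, hA', zpow_zero, one_mul]
      have : genT l h0 ^ tx g = SemidirectProduct.inr (Multiplicative.ofAdd 1 ^ tx g) := by
        rw [map_zpow]; rfl
      rw [this]
      change _ = _ + 0
      rw [add_zero]; rfl
    · rw [tx_mul, tx_zpow, hA']; simp
  rw [hg]
  refine K.mul_mem ?_ (K.zpow_mem hT _)
  have := hall _ (g.left.toAdd).2 1 hE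
  rwa [Subtype.coe_eta, mul_one] at this

end Coordinates

/-! ### The free metabelian group on two generators -/

theorem commute_of_closure_pair {G : Type*} [Group G] {a b : G}
    (hG : Subgroup.closure {a, b} = ⊤) (hab : a * b = b * a) (x y : G) : x * y = y * x := by
  have h1 : Subgroup.closure {a, b} ≤ Subgroup.centralizer {a, b} := by
    rw [Subgroup.closure_le]
    rintro z (rfl | rfl) w (rfl | rfl) <;> first | rfl | exact hab | exact hab.symm
  have h2 : Subgroup.closure {a, b} ≤ Subgroup.centralizer {y} := by
    rw [Subgroup.closure_le]
    intro z hz w hw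
    rw [Set.mem_singleton_iff.1 hw]
    have hy : y ∈ Subgroup.centralizer {a, b} := h1 (hG ▸ Subgroup.mem_top y)
    exact (hy z hz).symm
  have hx : x ∈ Subgroup.centralizer {y} := h2 (hG ▸ Subgroup.mem_top x)
  exact (hx y rfl).symm

theorem closure_genA_genB : Subgroup.closure {genA, genB} = ⊤ := by
  have h := Subgroup.map_top_of_surjective _
    (QuotientGroup.mk'_surjective (derivedSeries (FreeGroup (Fin 2)) 2))
  rw [← FreeGroup.closure_range_of, MonoidHom.map_closure, ← Set.range_comp] at h
  rw [← h]
  congr 1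
  ext g
  simp only [Set.mem_insert_iff, Set.mem_singleton_iff, Set.mem_range, Fin.exists_fin_two]
  exact or_congr eq_comm eq_comm

theorem closure_map_pair {G : Type*} [Group G] {π : FreeMetab2 →* G} (hπ : Function.Surjective π) :
    Subgroup.closure {π genA, π genB} = ⊤ := by
  rw [← Set.image_pair, ← MonoidHom.map_closure, closure_genA_genB,
    Subgroup.map_top_of_surjective _ hπ]

theorem metab_hom_ext {H : Type*} [Group H] {χ χ' : FreeMetab2 →* H} (ha : χ genA = χ' genA)
    (hb : χ genB = χ' genB) : χ = χ' := by
  refine MonoidHom.eq_of_eqOn_dense closure_genA_genB ?_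
  rintro z (rfl | rfl)
  · exact ha
  · exact hb

/-- The homomorphism from the free metabelian group to a metabelian group that is given by a
homomorphism from the free group. -/
def metabLift {H : Type*} [Group H] (h : derivedSeries H 2 = ⊥) (χ : FreeGroup (Fin 2) →* H) :
    FreeMetab2 →* H :=
  QuotientGroup.lift _ χ fun g hg => by
    have := map_derivedSeries_le_derivedSeries χ 2 (Subgroup.mem_map_of_mem χ hg)
    rwa [h, Subgroup.mem_bot] at this

/-- The homomorphism from the free metabelian group to a metabelian group with given values at the
generators. -/
def metabHom {H : Type*} [Group H] (h : derivedSeries H 2 = ⊥) (x y : H) : FreeMetab2 →* H :=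
  metabLift h (FreeGroup.lift ![x, y])

@[simp] theorem metabHom_genA {H : Type*} [Group H] (h : derivedSeries H 2 = ⊥) (x y : H) :
    metabHom h x y genA = x := by
  change FreeGroup.lift ![x, y] (FreeGroup.of 0) = x
  simp

@[simp] theorem metabHom_genB {H : Type*} [Group H] (h : derivedSeries H 2 = ⊥) (x y : H) :
    metabHom h x y genB = y := by
  change FreeGroup.lift ![x, y] (FreeGroup.of 1) = y
  simp

theorem derivedSeries_of_surjective {G H : Type*} [Group G] [Group H] {f : G →* H}
    (hf : Function.Surjective f) (h : derivedSeries G 2 = ⊥) : derivedSeries H 2 = ⊥ := by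
  rw [← map_derivedSeries_eq hf, h, Subgroup.map_bot]

theorem derivedSeries_freeMetab2 : derivedSeries FreeMetab2 2 = ⊥ := by
  rw [← map_derivedSeries_eq (QuotientGroup.mk'_surjective _), Subgroup.map_eq_bot_iff,
    QuotientGroup.ker_mk']

theorem derivedSeries_of_comm {H : Type*} [CommGroup H] : derivedSeries H 2 = ⊥ := by
  rw [derivedSeries_succ, eq_bot_iff, Subgroup.commutator_le]
  intro g _ h _
  rw [Subgroup.mem_bot, commutatorElement_eq_one_iff_mul_comm, mul_comm]

/-- The exponents of an element of the free metabelian group. -/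
def expo : FreeMetab2 →* Multiplicative (ℤ × ℤ) :=
  metabHom derivedSeries_of_comm (Multiplicative.ofAdd (1, 0)) (Multiplicative.ofAdd (0, 1))

/-- The exponent of `a`. -/
def expA (g : FreeMetab2) : ℤ := (expo g).toAdd.1

/-- The exponent of `b`. -/
def expB (g : FreeMetab2) : ℤ := (expo g).toAdd.2

@[simp] theorem expA_one : expA 1 = 0 := by simp [expA]
@[simp] theorem expB_one : expB 1 = 0 := by simp [expB]
@[simp] theorem expA_mul (g h : FreeMetab2) : expA (g * h) = expA g + expA h := by simp [expA]
@[simp] theorem expB_mul (g h : FreeMetab2) : expB (g * h) = expB g + expB h := by simp [expB]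
@[simp] theorem expA_inv (g : FreeMetab2) : expA g⁻¹ = - expA g := by simp [expA]
@[simp] theorem expB_inv (g : FreeMetab2) : expB g⁻¹ = - expB g := by simp [expB]
@[simp] theorem expA_zpow (g : FreeMetab2) (k : ℤ) : expA (g ^ k) = k * expA g := by simp [expA]
@[simp] theorem expB_zpow (g : FreeMetab2) (k : ℤ) : expB (g ^ k) = k * expB g := by simp [expB]
@[simp] theorem expA_genA : expA genA = 1 := by simp [expA, expo]
@[simp] theorem expB_genA : expB genA = 0 := by simp [expB, expo]
@[simp] theorem expA_genB : expA genB = 0 := by simp [expA, expo]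
@[simp] theorem expB_genB : expB genB = 1 := by simp [expB, expo]

theorem hom_apply_eq {H : Type*} [CommGroup H] (χ : FreeMetab2 →* H) (g : FreeMetab2) :
    χ g = χ genA ^ expA g * χ genB ^ expB g := by
  let χ' : FreeMetab2 →* H :=
    { toFun := fun g => χ genA ^ expA g * χ genB ^ expB g
      map_one' := by simp
      map_mul' := fun g h => by rw [expA_mul, expB_mul, zpow_add, zpow_add, mul_mul_mul_comm] }
  have : χ = χ' := metab_hom_ext (by simp [χ']) (by simp [χ'])
  exact DFunLike.congr_fun this g

theorem mem_commutator_iff {g : FreeMetab2} :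
    g ∈ commutator FreeMetab2 ↔ expA g = 0 ∧ expB g = 0 := by
  constructor
  · intro hg
    have h : expo g = 1 := Abelianization.commutator_subset_ker expo hg
    simp [expA, expB, h]
  · rintro ⟨h1, h2⟩
    have h := hom_apply_eq (Abelianization.of (G := FreeMetab2)) g
    rw [h1, h2, zpow_zero, zpow_zero, one_mul] at h
    rwa [← MonoidHom.mem_ker, Abelianization.ker_of] at h

theorem coe_commC : (commC : FreeMetab2) = ⁅genA, genB⁆ := rfl

@[simp] theorem commPow_zero : commPow 0 = 1 := by
  simp [commPow]

theorem commPow_single (e : ℤ × ℤ) (n : ℤ) :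
    commPow (AddMonoidAlgebra.single e n) =
      MulAut.conjNormal (genA ^ e.1 * genB ^ e.2) (commC ^ n) := by
  rw [commPow, AddMonoidAlgebra.coeff_single, Finsupp.prod_single_index (by simp)]

theorem commPow_add (P Q : Laurent2) : commPow (P + Q) = commPow P * commPow Q := by
  rw [commPow, AddMonoidAlgebra.coeff_add]
  exact Finsupp.prod_add_index' (by simp) (by intro e m n; rw [zpow_add, map_mul])

theorem commPow_one : commPow 1 = commC := by
  rw [AddMonoidAlgebra.one_def, commPow_single]
  simp only [Prod.fst_zero, Prod.snd_zero, zpow_zero, mul_one, zpow_one, map_one]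
  rfl

/-- `P ↦ c^P` as a homomorphism. -/
def commPowHom : Multiplicative Laurent2 →* commutator FreeMetab2 where
  toFun P := commPow P.toAdd
  map_one' := commPow_zero
  map_mul' _ _ := commPow_add _ _

/-- The derived subgroup is abelian, so it acts trivially on itself and conjugation depends only on
the exponents. -/
theorem conjNormal_congr {g h : FreeMetab2} (hA : expA g = expA h) (hB : expB g = expB h)
    (m : commutator FreeMetab2) : MulAut.conjNormal g m = MulAut.conjNormal h m := by
  have hk : h⁻¹ * g ∈ commutator FreeMetab2 := mem_commutator_iff.2 (by simp [hA, hB])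
  have hg : g = h * (h⁻¹ * g) := by group
  rw [hg, map_mul, MulAut.mul_apply]
  congr 1
  apply Subtype.ext
  rw [MulAut.conjNormal_apply, mul_inv_eq_iff_eq_mul]
  exact congrArg Subtype.val (commutator_comm ⟨_, hk⟩ m)

theorem conjNormal_commPow (g : FreeMetab2) (P : Laurent2) :
    MulAut.conjNormal g (commPow P) =
      commPow (AddMonoidAlgebra.single (expA g, expB g) 1 * P) := by
  induction P using AddMonoidAlgebra.induction_linear with
  | zero => simp
  | add P Q hP hQ => rw [commPow_add, map_mul, hP, hQ, mul_add, commPow_add]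
  | single e n =>
    rw [AddMonoidAlgebra.single_mul_single, commPow_single, commPow_single, one_mul,
      ← MulAut.mul_apply, ← map_mul]
    apply conjNormal_congr <;> simp

theorem conj_commPow (g : FreeMetab2) (P : Laurent2) :
    g * commPow P * g⁻¹ = commPow (AddMonoidAlgebra.single (expA g, expB g) 1 * P) := by
  rw [← conjNormal_commPow, MulAut.conjNormal_apply]

/-- The elements `c^P` form a normal subgroup. Modulo it the two generators commute, so the quotient
is abelian. -/
theorem exists_commPow_eq {g : FreeMetab2} (hg : g ∈ commutator FreeMetab2) :
    ∃ P, (commPow P : FreeMetab2) = g := by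
  let K : Subgroup FreeMetab2 := commPowHom.range.map (commutator FreeMetab2).subtype
  have hmem : ∀ g, g ∈ K ↔ ∃ P, (commPow P : FreeMetab2) = g := by
    intro g
    constructor
    · rintro ⟨_, ⟨P, rfl⟩, rfl⟩
      exact ⟨P.toAdd, rfl⟩
    · rintro ⟨P, rfl⟩
      exact ⟨_, ⟨Multiplicative.ofAdd P, rfl⟩, rfl⟩
  have hN : K.Normal := by
    refine ⟨fun n hn g => ?_⟩
    rw [hmem] at hn ⊢
    obtain ⟨P, rfl⟩ := hn
    exact ⟨_, (conj_commPow g P).symm⟩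
  refine (hmem g).1 ?_
  refine (Subgroup.Normal.quotient_commutative_iff_commutator_le (N := K)).1 ⟨⟨?_⟩⟩ hg
  refine commute_of_closure_pair (closure_map_pair (QuotientGroup.mk'_surjective K)) ?_
  have hc : ⁅genA, genB⁆ ∈ K := (hmem _).2 ⟨1, by rw [commPow_one, coe_commC]⟩
  rw [← commutatorElement_eq_one_iff_mul_comm, ← map_commutatorElement]
  exact (QuotientGroup.eq_one_iff _).2 hc

/-! ### Homomorphisms from the free metabelian group to `G(l)` -/

/-- Evaluation of Laurent polynomials at a nonzero complex number. -/
def evT (l : ℂ) (h0 : l ≠ 0) : LaurentPolynomial ℤ →+* ℂ :=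
  LaurentPolynomial.eval₂ (Int.castRingHom ℂ) (Units.mk0 l h0)

theorem evT_single (l : ℂ) (h0 : l ≠ 0) (k n : ℤ) :
    evT l h0 (AddMonoidAlgebra.single k n) = n * l ^ k := by
  rw [LaurentPolynomial.single_eq_C_mul_T, evT, LaurentPolynomial.eval₂_C_mul_T]
  simp

theorem evT_toLaurent (l : ℂ) (h0 : l ≠ 0) (P : ℤ[X]) :
    evT l h0 (toLaurent P) = aeval l P := by
  rw [evT, LaurentPolynomial.eval₂_toLaurent]
  rfl

/-- The linear form `(i, j) ↦ p i + q j`. -/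
def linForm (p q : ℤ) : ℤ × ℤ →+ ℤ :=
  (AddMonoidHom.mulLeft p).comp (AddMonoidHom.fst ℤ ℤ) +
    (AddMonoidHom.mulLeft q).comp (AddMonoidHom.snd ℤ ℤ)

@[simp] theorem linForm_apply (p q : ℤ) (e : ℤ × ℤ) : linForm p q e = p * e.1 + q * e.2 := rfl

/-- The substitution `x ↦ T ^ p`, `y ↦ T ^ q`. -/
def substT (p q : ℤ) : Laurent2 →+* LaurentPolynomial ℤ :=
  AddMonoidAlgebra.mapDomainRingHom ℤ (linForm p q)

theorem substT_single (p q : ℤ) (e : ℤ × ℤ) (n : ℤ) :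
    substT p q (AddMonoidAlgebra.single e n) = AddMonoidAlgebra.single (p * e.1 + q * e.2) n := by
  rw [substT, AddMonoidAlgebra.mapDomainRingHom_apply, AddMonoidAlgebra.mapDomain_single]
  rfl

/-- Evaluation at `x = l ^ p`, `y = l ^ q`. -/
def ev (l : ℂ) (h0 : l ≠ 0) (p q : ℤ) : Laurent2 →+* ℂ := (evT l h0).comp (substT p q)

theorem ev_apply (l : ℂ) (h0 : l ≠ 0) (p q : ℤ) (P : Laurent2) :
    ev l h0 p q P = evT l h0 (substT p q P) := rfl

theorem ev_single (l : ℂ) (h0 : l ≠ 0) (p q : ℤ) (e : ℤ × ℤ) (n : ℤ) :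
    ev l h0 p q (AddMonoidAlgebra.single e n) = n * l ^ (p * e.1 + q * e.2) := by
  rw [ev_apply, substT_single, evT_single]

section Hom

variable {l : ℂ} {h0 : l ≠ 0} (χ : FreeMetab2 →* GGroup l h0)

theorem tx_hom (g : FreeMetab2) :
    tx (χ g) = tx (χ genA) * expA g + tx (χ genB) * expB g := by
  have h := congrArg Multiplicative.toAdd (hom_apply_eq (txHom.comp χ) g)
  rw [toAdd_mul, toAdd_zpow, toAdd_zpow, smul_eq_mul, smul_eq_mul, mul_comm (expA g),
    mul_comm (expB g)] at h
  exact h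

theorem tx_hom_of_mem_commutator {g : FreeMetab2} (hg : g ∈ commutator FreeMetab2) :
    tx (χ g) = 0 := by
  rw [tx_hom, (mem_commutator_iff.1 hg).1, (mem_commutator_iff.1 hg).2, mul_zero, mul_zero,
    add_zero]

/-- Conjugation by `a^i b^j` becomes multiplication by `l^(p i + q j)`, the value of the monomial
`x^i y^j` at `(l^p, l^q)`. -/
theorem lc_hom_commPow (P : Laurent2) :
    lc (χ (commPow P)) = ev l h0 (tx (χ genA)) (tx (χ genB)) P * lc (χ commC) := by
  induction P using AddMonoidAlgebra.induction_linear with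
  | zero => simp
  | add P Q hP hQ =>
    rw [commPow_add, Subgroup.coe_mul, map_mul, lc_mul, hP, hQ,
      tx_hom_of_mem_commutator χ (commPow P).2, zpow_zero, one_mul, map_add, add_mul]
  | single e n =>
    rw [commPow_single, MulAut.conjNormal_apply, map_mul, map_mul, map_inv,
      lc_conj _ _ (tx_hom_of_mem_commutator χ (commC ^ n).2), ev_single]
    have h1 : lc (χ ((commC ^ n : commutator FreeMetab2) : FreeMetab2)) = n * lc (χ commC) := by
      induction n with
      | zero => simp
      | succ n ih =>
        rw [zpow_add_one, Subgroup.coe_mul, map_mul, lc_mul, ih,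
          tx_hom_of_mem_commutator χ (commC ^ (n : ℤ)).2]
        push_cast
        rw [zpow_zero]
        ring
      | pred n ih =>
        rw [zpow_sub_one, Subgroup.coe_mul, map_mul, lc_mul, ih,
          tx_hom_of_mem_commutator χ (commC ^ (-(n : ℤ))).2, Subgroup.coe_inv, map_inv, lc_inv,
          tx_hom_of_mem_commutator χ commC.2]
        push_cast
        simp only [neg_zero, zpow_zero]
        ring
    rw [h1, tx_hom]
    simp
    ring

theorem hom_commPow_eq_one_iff (hc : lc (χ commC) ≠ 0) (P : Laurent2) :
    χ (commPow P) = 1 ↔ ev l h0 (tx (χ genA)) (tx (χ genB)) P = 0 := by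
  rw [eq_one_iff_lc_tx, lc_hom_commPow, tx_hom_of_mem_commutator χ (commPow P).2]
  simp [hc]

theorem exists_commPow_eq_commutator (g : FreeMetab2) :
    ∃ P, (commPow P : FreeMetab2) = ⁅genA, g⁆ :=
  exists_commPow_eq (Subgroup.commutator_mem_commutator (Subgroup.mem_top _) (Subgroup.mem_top _))

/-- A Laurent polynomial `P` with `c ^ P = [a, g]`. -/
def commPoly (g : FreeMetab2) : Laurent2 := (exists_commPow_eq_commutator g).choose

theorem commPow_commPoly (g : FreeMetab2) : (commPow (commPoly g) : FreeMetab2) = ⁅genA, g⁆ :=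
  (exists_commPow_eq_commutator g).choose_spec

/-- If `χ g` has exponent `0`, the `ℤ[l, l⁻¹]`-component of `[χ a, χ g]` is `l^p - 1` times that of
`χ g`. As `[a, g]` is a `c^P`, the vanishing of this component becomes that of a polynomial value.
Neither the image of `c` nor the values at the generators enter the criterion. -/
theorem hom_eq_one_iff (hc : lc (χ commC) ≠ 0) (ha : l ^ tx (χ genA) ≠ 1) (g : FreeMetab2) :
    χ g = 1 ↔ tx (χ genA) * expA g + tx (χ genB) * expB g = 0 ∧
      ev l h0 (tx (χ genA)) (tx (χ genB)) (commPoly g) = 0 := by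
  rw [← tx_hom, eq_one_iff_lc_tx, and_comm]
  refine and_congr_right fun hg => ?_
  have h := lc_hom_commPow χ (commPoly g)
  rw [commPow_commPoly, map_commutatorElement, lc_commutator, hg, zpow_zero, sub_self, zero_mul,
    sub_zero] at h
  constructor
  · intro h1
    rw [h1, mul_zero, eq_comm, mul_eq_zero] at h
    exact h.resolve_right hc
  · intro h1
    rw [h1, zero_mul, mul_eq_zero] at h
    exact h.resolve_left (sub_ne_zero.2 ha)

end Hom

/-! ### Minimal polynomials over `ℤ` -/

theorem intMinpoly_spec {l : ℂ} (h : IsAlgebraic ℤ l) : IsIntMinpoly l (intMinpoly l) := by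
  rw [intMinpoly, dif_pos h]
  exact (existsUnique_intMinpoly l h).choose_spec.1

theorem intMinpoly_of_not_isAlgebraic {l : ℂ} (h : ¬ IsAlgebraic ℤ l) : intMinpoly l = 0 := by
  rw [intMinpoly, dif_neg h]

theorem IsIntMinpoly.isAlgebraic {l : ℂ} {P : ℤ[X]} (h : IsIntMinpoly l P) : IsAlgebraic ℤ l :=
  ⟨P, h.1.ne_zero, h.2.1⟩

theorem IsIntMinpoly.intMinpoly_eq {l : ℂ} {P : ℤ[X]} (h : IsIntMinpoly l P) :
    intMinpoly l = P :=
  (existsUnique_intMinpoly l h.isAlgebraic).unique (intMinpoly_spec h.isAlgebraic) h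

/-- Gauss's lemma: `P` is primitive, so divisibility can be tested over `ℚ`, where `P` is associated
to `minpoly ℚ l`. -/
theorem IsIntMinpoly.dvd {l : ℂ} {P Q : ℤ[X]} (h : IsIntMinpoly l P) (hQ : aeval l Q = 0) :
    P ∣ Q := by
  have hdeg : P.natDegree ≠ 0 := by
    intro hd
    have h1 := h.2.1
    rw [eq_C_of_natDegree_eq_zero hd, aeval_C, algebraMap_int_eq, eq_intCast,
      Int.cast_eq_zero] at h1
    apply h.1.ne_zero
    rw [eq_C_of_natDegree_eq_zero hd, h1, C_0]
  have hp := h.1.isPrimitive hdeg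
  refine (IsPrimitive.Int.dvd_iff_map_cast_dvd_map_cast P Q hp).2 ?_
  have hi := (IsPrimitive.Int.irreducible_iff_irreducible_map_cast hp).1 h.1
  have e : ∀ S : ℤ[X], aeval l (S.map (Int.castRingHom ℚ)) = aeval l S :=
    fun S => aeval_map_algebraMap ℚ l S
  have h1 : minpoly ℚ l ∣ P.map (Int.castRingHom ℚ) := minpoly.dvd _ _ (by rw [e, h.2.1])
  have h2 : minpoly ℚ l ∣ Q.map (Int.castRingHom ℚ) := minpoly.dvd _ _ (by rw [e, hQ])
  exact ((hi.dvd_iff.1 h1).resolve_left (minpoly.not_isUnit ℚ l)).dvd.trans h2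

theorem aeval_intMinpoly (l : ℂ) : aeval l (intMinpoly l) = 0 := by
  by_cases h : IsAlgebraic ℤ l
  · exact (intMinpoly_spec h).2.1
  · rw [intMinpoly_of_not_isAlgebraic h, map_zero]

theorem aeval_eq_zero_iff_intMinpoly_dvd (l : ℂ) (Q : ℤ[X]) :
    aeval l Q = 0 ↔ intMinpoly l ∣ Q := by
  constructor
  · intro hQ
    by_cases h : IsAlgebraic ℤ l
    · exact (intMinpoly_spec h).dvd hQ
    · have : Q = 0 := by
        by_contra hne
        exact h ⟨Q, hne, hQ⟩
      rw [this]
      exact dvd_zero _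
  · rintro ⟨R, rfl⟩
    rw [map_mul, aeval_intMinpoly, zero_mul]

theorem evT_eq_zero_iff (l : ℂ) (h0 : l ≠ 0) (Q : LaurentPolynomial ℤ) :
    evT l h0 Q = 0 ↔ toLaurent (intMinpoly l) ∣ Q := by
  constructor
  · intro hQ
    obtain ⟨n, R, hR⟩ := Q.exists_T_pow
    have h1 : aeval l R = 0 := by rw [← evT_toLaurent l h0, hR, map_mul, hQ, zero_mul]
    have h2 := map_dvd (toLaurent (R := ℤ)) ((aeval_eq_zero_iff_intMinpoly_dvd l R).1 h1)
    rw [hR] at h2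
    exact ((LaurentPolynomial.isUnit_T (n : ℤ)).dvd_mul_right).1 h2
  · rintro ⟨R, rfl⟩
    rw [map_mul, evT_toLaurent, aeval_intMinpoly, zero_mul]

theorem intMinpoly_eq_of_aeval_eq_zero {l z : ℂ} (h : IsAlgebraic ℤ l)
    (hz : aeval z (intMinpoly l) = 0) : intMinpoly z = intMinpoly l :=
  IsIntMinpoly.intMinpoly_eq ⟨(intMinpoly_spec h).1, hz, (intMinpoly_spec h).2.2⟩

theorem intMinpoly_one : intMinpoly 1 = X - 1 :=
  IsIntMinpoly.intMinpoly_eq ⟨by simpa using irreducible_X_sub_C (1 : ℤ), by simp, by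
    have := leadingCoeff_X_sub_C (1 : ℤ)
    rw [C_1] at this
    rw [this]
    exact one_pos⟩

theorem ne_one_of_intMinpoly_eq {l z : ℂ} (h1 : l ≠ 1) (hz : intMinpoly z = intMinpoly l) :
    z ≠ 1 := by
  rintro rfl
  have h := aeval_intMinpoly l
  rw [← hz, intMinpoly_one] at h
  simp only [map_sub, aeval_X, map_one] at h
  exact h1 (sub_eq_zero.1 h)

/-! ### Powers of `l` and roots of unity -/

theorem isAlgebraic_of_zpow {l : ℂ} {k : ℤ} (hk : k ≠ 0) (h : IsAlgebraic ℤ (l ^ k)) :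
    IsAlgebraic ℤ l := by
  obtain ⟨n, rfl | rfl⟩ := k.eq_nat_or_neg
  · rw [zpow_natCast] at h
    exact h.of_pow (by omega)
  · rw [zpow_neg, zpow_natCast, IsAlgebraic.inv_iff] at h
    exact h.of_pow (by omega)

theorem isIntMinpoly_cyclotomic {l : ℂ} (h : IsOfFinOrder l) :
    IsIntMinpoly l (cyclotomic (orderOf l) ℤ) := by
  have hpos : 0 < orderOf l := h.orderOf_pos
  refine ⟨cyclotomic.irreducible hpos, ?_, by rw [(cyclotomic.monic _ ℤ).leadingCoeff]; exact one_pos⟩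
  have h1 := (IsPrimitiveRoot.orderOf l).isRoot_cyclotomic hpos
  rw [IsRoot.def, ← map_cyclotomic_int, eval_map] at h1
  exact h1

theorem isPrimitiveRoot_of_aeval_cyclotomic {z : ℂ} {m : ℕ} (hm : 0 < m)
    (h : aeval z (cyclotomic m ℤ) = 0) : IsPrimitiveRoot z m := by
  have : NeZero (m : ℂ) := ⟨by exact_mod_cast hm.ne'⟩
  rw [← isRoot_cyclotomic_iff, IsRoot.def, ← map_cyclotomic_int, eval_map]
  exact h

theorem zpow_injective_of_not_isOfFinOrder {l : ℂ} (h0 : l ≠ 0) (h : ¬ IsOfFinOrder l) :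
    Function.Injective fun k : ℤ => l ^ k := by
  have h1 : ¬ IsOfFinOrder (Units.mk0 l h0) := by
    rwa [← Units.isOfFinOrder_val]
  intro i j hij
  apply injective_zpow_iff_not_isOfFinOrder.2 h1
  apply Units.ext
  simpa using hij

/-- Conjugate numbers satisfy the same polynomial relations, so all `l^(k^n)` are roots of
`intMinpoly l`. There are finitely many roots and the powers of `l` are distinct, so `k^n` takes
finitely many values and `|k| ≤ 1`; `k = 0` would make `1` conjugate to `l`. -/
theorem eq_one_or_neg_one_of_aeval_zpow {l : ℂ} (h0 : l ≠ 0) (h1 : l ≠ 1)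
    (hfin : ¬ IsOfFinOrder l) (halg : IsAlgebraic ℤ l) {k : ℤ}
    (hk : aeval (l ^ k) (intMinpoly l) = 0) : k = 1 ∨ k = -1 := by
  have heq : ∀ n : ℕ, intMinpoly (l ^ (k ^ n)) = intMinpoly l := by
    intro n
    induction n with
    | zero => simp
    | succ n ih =>
      -- The polynomial `P_l(T^(k^n))` vanishes at `l` by induction, hence at its conjugate `l^k`.
      have h2 : evT (l ^ k) (zpow_ne_zero _ h0)
          (AddMonoidAlgebra.mapDomain (fun i => k ^ n * i) (toLaurent (intMinpoly l))) = 0 := by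
        rw [evT_eq_zero_iff, intMinpoly_eq_of_aeval_eq_zero halg hk, ← evT_eq_zero_iff l h0]
        have : ∀ Q : LaurentPolynomial ℤ,
            evT l h0 (AddMonoidAlgebra.mapDomain (fun i => k ^ n * i) Q) =
              evT (l ^ (k ^ n)) (zpow_ne_zero _ h0) Q := by
          intro Q
          induction Q using AddMonoidAlgebra.induction_linear with
          | zero => simp
          | add P Q hP hQ => rw [AddMonoidAlgebra.mapDomain_add, map_add, map_add, hP, hQ]
          | single i c =>
            rw [AddMonoidAlgebra.mapDomain_single, evT_single, evT_single, zpow_mul]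
        rw [this, evT_toLaurent, ← ih, aeval_intMinpoly]
      refine intMinpoly_eq_of_aeval_eq_zero halg ?_
      have : ∀ Q : LaurentPolynomial ℤ,
          evT (l ^ k) (zpow_ne_zero _ h0) (AddMonoidAlgebra.mapDomain (fun i => k ^ n * i) Q) =
            evT (l ^ (k ^ (n + 1))) (zpow_ne_zero _ h0) Q := by
        intro Q
        induction Q using AddMonoidAlgebra.induction_linear with
        | zero => simp
        | add P Q hP hQ => rw [AddMonoidAlgebra.mapDomain_add, map_add, map_add, hP, hQ]
        | single i c =>
          rw [AddMonoidAlgebra.mapDomain_single, evT_single, evT_single, ← zpow_mul, ← zpow_mul]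
          congr 2; ring
      rwa [this, evT_toLaurent] at h2
  have hmem : ∀ n : ℕ, l ^ (k ^ n) ∈ (intMinpoly l).rootSet ℂ := by
    intro n
    rw [mem_rootSet]
    refine ⟨(intMinpoly_spec halg).1.ne_zero, ?_⟩
    rw [← heq n, aeval_intMinpoly]
  have hninj : ¬ Function.Injective fun n : ℕ => k ^ n := by
    intro hinj
    refine Set.infinite_range_of_injective
      ((zpow_injective_of_not_isOfFinOrder h0 hfin).comp hinj) ?_
    refine ((intMinpoly l).rootSet_finite ℂ).subset ?_
    rintro _ ⟨n, rfl⟩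
    exact hmem n
  by_contra hcon
  push Not at hcon
  have hk0 : k ≠ 0 := by
    rintro rfl
    have := ne_one_of_intMinpoly_eq h1 (heq 1)
    simp at this
  apply hninj
  intro i j hij
  have h3 : k.natAbs ^ i = k.natAbs ^ j := by
    rw [← Int.natAbs_pow, ← Int.natAbs_pow]
    exact congrArg Int.natAbs hij
  exact Nat.pow_right_injective (by omega) h3

/-! ### The ideals that define the groups `M(l)` -/

theorem evT_zpow (l : ℂ) (h0 : l ≠ 0) {p q : ℤ} (hq : l ^ q = 1) (P : Laurent2) :
    ev l h0 p q P = evT (l ^ p) (zpow_ne_zero _ h0) (substT 1 0 P) := by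
  induction P using AddMonoidAlgebra.induction_linear with
  | zero => simp
  | add P Q hP hQ => rw [map_add, map_add, map_add, hP, hQ]
  | single e n =>
    rw [ev_single, substT_single, evT_single, zpow_add₀ h0, zpow_mul l q, hq, one_zpow, mul_one,
      one_mul, zero_mul, add_zero, zpow_mul]

/-- The inclusion of the Laurent polynomials in `x`. -/
def inclX : LaurentPolynomial ℤ →+* Laurent2 :=
  AddMonoidAlgebra.mapDomainRingHom ℤ (AddMonoidHom.inl ℤ ℤ)

theorem inclX_single (k n : ℤ) :
    inclX (AddMonoidAlgebra.single k n) = AddMonoidAlgebra.single (k, 0) n := by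
  rw [inclX, AddMonoidAlgebra.mapDomainRingHom_apply, AddMonoidAlgebra.mapDomain_single]
  rfl

theorem inclX_toLaurent (P : ℤ[X]) : inclX (toLaurent P) = aeval varX P := by
  have : (inclX.comp toLaurent : ℤ[X] →+* Laurent2) = (aeval varX : ℤ[X] →ₐ[ℤ] Laurent2) := by
    refine Polynomial.ringHom_ext' (RingHom.ext_int _ _) ?_
    rw [RingHom.comp_apply, toLaurent_X, LaurentPolynomial.T, inclX_single]
    simp [varX]
  exact DFunLike.congr_fun this P

theorem ev_inclX (l : ℂ) (h0 : l ≠ 0) (p q : ℤ) (R : LaurentPolynomial ℤ) :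
    ev l h0 p q (inclX R) = evT (l ^ p) (zpow_ne_zero _ h0) R := by
  induction R using AddMonoidAlgebra.induction_linear with
  | zero => simp
  | add P Q hP hQ => rw [map_add, map_add, map_add, hP, hQ]
  | single k n =>
    rw [inclX_single, ev_single, evT_single, mul_zero, add_zero, zpow_mul]

theorem ev_aeval_varX (l : ℂ) (h0 : l ≠ 0) (p q : ℤ) (P : ℤ[X]) :
    ev l h0 p q (aeval varX P) = aeval (l ^ p) P := by
  rw [← inclX_toLaurent, ev_inclX, evT_toLaurent]

/-! ### Ideal membership from vanishing of values -/

theorem exists_sum_inclX (Q : Laurent2) :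
    ∃ f : ℤ →₀ LaurentPolynomial ℤ,
      Q = f.sum fun j R => inclX R * AddMonoidAlgebra.single (0, j) 1 := by
  induction Q using AddMonoidAlgebra.induction_linear with
  | zero => exact ⟨0, by simp⟩
  | add P Q hP hQ =>
    obtain ⟨f, hf⟩ := hP
    obtain ⟨g, hg⟩ := hQ
    refine ⟨f + g, ?_⟩
    rw [Finsupp.sum_add_index' (by simp) (by intro j R S; rw [map_add, add_mul]), ← hf, ← hg]
  | single e n =>
    refine ⟨Finsupp.single e.2 (AddMonoidAlgebra.single e.1 n), ?_⟩
    rw [Finsupp.sum_single_index (by simp), inclX_single, AddMonoidAlgebra.single_mul_single]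
    simp

theorem laurent_eq_zero_of_infinite {F : LaurentPolynomial ℂ} {S : Set ℂˣ} (hS : S.Infinite)
    (hF : ∀ z ∈ S, LaurentPolynomial.eval₂ (RingHom.id ℂ) z F = 0) : F = 0 := by
  obtain ⟨n, R, hR⟩ := F.exists_T_pow
  have hR0 : R = 0 := by
    refine Polynomial.eq_zero_of_infinite_isRoot R ?_
    refine (hS.image (f := Units.val) Units.val_injective.injOn).mono ?_
    rintro _ ⟨z, hz, rfl⟩
    have h := LaurentPolynomial.eval₂_toLaurent (RingHom.id ℂ) z R
    rw [hR, map_mul, hF z hz, zero_mul] at h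
    exact h.symm
  rw [hR0, map_zero, eq_comm] at hR
  exact ((LaurentPolynomial.isUnit_T (n : ℤ)).mul_left_eq_zero).1 hR

/-- Write `Q = ∑ R_j(x) y^j`. At `x = l` it becomes a Laurent polynomial in `y` with infinitely many
zeros `l^q`, so each `R_j(l)` is `0` and `P_l` divides each `R_j`. -/
theorem mem_span_of_infinite {l : ℂ} {h0 : l ≠ 0} (hfin : ¬ IsOfFinOrder l) {S : Set ℤ}
    (hS : S.Infinite) {Q : Laurent2} (hQ : ∀ q ∈ S, ev l h0 1 q Q = 0) :
    Q ∈ Ideal.span {aeval varX (intMinpoly l)} := by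
  obtain ⟨f, rfl⟩ := exists_sum_inclX Q
  let F : LaurentPolynomial ℂ := .ofCoeff (f.mapRange (evT l h0) (map_zero _))
  have hF : F = f.sum fun j R => AddMonoidAlgebra.single j (evT l h0 R) := by
    rw [← AddMonoidAlgebra.sum_coeff_single F]
    exact Finsupp.sum_mapRange_index (hf := map_zero _) (by simp)
  have hF0 : F = 0 := by
    refine laurent_eq_zero_of_infinite (S := (fun q : ℤ => (Units.mk0 l h0) ^ q) '' S) ?_ ?_
    · refine hS.image (Function.Injective.injOn fun i j hij => ?_)
      refine zpow_injective_of_not_isOfFinOrder h0 hfin ?_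
      simpa using congrArg Units.val hij
    · rintro _ ⟨q, hq, rfl⟩
      rw [hF, ← hQ q hq, Finsupp.sum, Finsupp.sum, map_sum, map_sum]
      refine Finset.sum_congr rfl fun j _ => ?_
      rw [map_mul, ev_inclX, ev_single, LaurentPolynomial.single_eq_C_mul_T,
        LaurentPolynomial.eval₂_C_mul_T]
      simp [zpow_mul]
  refine Ideal.sum_mem _ fun j _ => Ideal.mul_mem_right _ _ ?_
  have hj : evT l h0 (f j) = 0 := by
    have : F.coeff j = 0 := by rw [hF0]; rfl
    exact this
  rw [Ideal.mem_span_singleton, ← inclX_toLaurent]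
  exact map_dvd inclX ((evT_eq_zero_iff l h0 _).1 hj)

theorem sub_inclX_mem_span (Q : Laurent2) :
    Q - inclX (substT 1 0 Q) ∈ Ideal.span {varY - 1} := by
  induction Q using AddMonoidAlgebra.induction_linear with
  | zero => simp
  | add P Q hP hQ =>
    rw [map_add, map_add, add_sub_add_comm]
    exact Ideal.add_mem _ hP hQ
  | single e n =>
    rw [substT_single, inclX_single]
    have h1 : ∀ j : ℤ, (AddMonoidAlgebra.single (0, j) 1 - 1 : Laurent2) ∈
        Ideal.span {varY - 1} := by
      intro j
      rw [← Ideal.Quotient.eq_zero_iff_mem, map_sub, map_one, sub_eq_zero]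
      have hu : Ideal.Quotient.mk (Ideal.span {varY - 1}) varY = 1 := by
        rw [← sub_eq_zero, ← map_one (Ideal.Quotient.mk (Ideal.span {varY - 1})), ← map_sub,
          Ideal.Quotient.eq_zero_iff_mem]
        exact Ideal.mem_span_singleton_self _
      have hmul : ∀ i j : ℤ, (AddMonoidAlgebra.single (0, i + j) 1 : Laurent2) =
          AddMonoidAlgebra.single (0, i) 1 * AddMonoidAlgebra.single (0, j) 1 := by
        intro i j
        rw [AddMonoidAlgebra.single_mul_single]
        simp
      induction j with
      | zero => exact map_one _
      | succ j ih => rw [hmul, map_mul, ih, one_mul]; exact hu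
      | pred j ih =>
        have h2 := hmul (-(j : ℤ) - 1) 1
        rw [sub_add_cancel] at h2
        rw [h2, map_mul] at ih
        exact (mul_one _).symm.trans ((congrArg _ hu.symm).trans ih)
    have h2 : (AddMonoidAlgebra.single e n - AddMonoidAlgebra.single (1 * e.1 + 0 * e.2, 0) n :
        Laurent2) = AddMonoidAlgebra.single (e.1, 0) n * (AddMonoidAlgebra.single (0, e.2) 1 - 1)
        := by
      rw [mul_sub, AddMonoidAlgebra.single_mul_single, mul_one]
      simp
    rw [h2]
    exact Ideal.mul_mem_left _ _ (h1 _)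

theorem mem_idealOf_iff_of_isOfFinOrder {l : ℂ} (h0 : l ≠ 0) (hfin : IsOfFinOrder l)
    (Q : Laurent2) : Q ∈ idealOf l ↔ evT l h0 (substT 1 0 Q) = 0 := by
  rw [idealOf, if_pos hfin]
  have hy : ev l h0 1 0 (varY - 1) = 0 := by
    rw [map_sub, map_one, varY, ev_single]; simp
  have hev : ∀ P, ev l h0 1 0 P = evT l h0 (substT 1 0 P) := fun P => rfl
  rw [← (isIntMinpoly_cyclotomic hfin).intMinpoly_eq]
  constructor
  · intro hQ
    rw [← hev, ← RingHom.mem_ker]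
    refine (Ideal.span_le.2 ?_) hQ
    rintro P (rfl | rfl)
    · change ev l h0 1 0 _ = 0
      rw [ev_aeval_varX, zpow_one, aeval_intMinpoly]
    · exact hy
  · intro hQ
    rw [← sub_add_cancel Q (inclX (substT 1 0 Q))]
    refine Ideal.add_mem _ ?_ ?_
    · exact Ideal.span_mono (by simp) (sub_inclX_mem_span Q)
    · refine Ideal.span_mono (s := {aeval varX (intMinpoly l)}) (by simp) ?_
      rw [Ideal.mem_span_singleton, ← inclX_toLaurent]
      exact map_dvd inclX ((evT_eq_zero_iff l h0 _).1 hQ)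

theorem ev_eq_zero_of_mem_idealOf {l : ℂ} (h0 : l ≠ 0) (hfin : ¬ IsOfFinOrder l) (q : ℤ)
    {Q : Laurent2} (hQ : Q ∈ idealOf l) : ev l h0 1 q Q = 0 := by
  rw [idealOf, if_neg hfin, Ideal.mem_span_singleton] at hQ
  obtain ⟨R, rfl⟩ := hQ
  rw [map_mul, ev_aeval_varX, zpow_one, aeval_intMinpoly, zero_mul]

theorem mem_idealOf_of_infinite {l : ℂ} {h0 : l ≠ 0} (hfin : ¬ IsOfFinOrder l) {S : Set ℤ}
    (hS : S.Infinite) {Q : Laurent2} (hQ : ∀ q ∈ S, ev l h0 1 q Q = 0) : Q ∈ idealOf l := by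
  rw [idealOf, if_neg hfin]
  exact mem_span_of_infinite hfin hS hQ

/-- Evaluation at a transcendental number is injective, and by `hinj` the substitution merges no two
monomials of `Q`. -/
theorem eq_zero_of_ev_eq_zero_of_not_isAlgebraic {l : ℂ} {h0 : l ≠ 0} (h : ¬ IsAlgebraic ℤ l)
    {p q : ℤ} {Q : Laurent2}
    (hinj : Set.InjOn (linForm p q) (Q.coeff.support : Set (ℤ × ℤ))) (hQ : ev l h0 p q Q = 0) :
    Q = 0 := by
  rw [ev_apply, evT_eq_zero_iff, intMinpoly_of_not_isAlgebraic h, map_zero, zero_dvd_iff] at hQ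
  have h1 : Finsupp.mapDomain (linForm p q) Q.coeff = Finsupp.mapDomain (linForm p q) 0 := by
    rw [Finsupp.mapDomain_zero]
    exact congrArg AddMonoidAlgebra.coeff hQ
  have h2 := Finsupp.mapDomain_injOn _ hinj (Set.Subset.refl _) (by simp) h1
  exact congrArg AddMonoidAlgebra.ofCoeff h2

/-! ### The groups `M(l)` as limits of `G(l)` -/

theorem exists_injective_hom_of_ker_eq {F G H : Type*} [Group F] [Group G] [Group H]
    {π : F →* G} (hπ : Function.Surjective π) {ρ : F →* H} (h : ∀ g, π g = 1 ↔ ρ g = 1) :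
    ∃ f : G →* H, Function.Injective f ∧ ∀ g, f (π g) = ρ g := by
  let f : G →* H := π.liftOfSurjective hπ ⟨ρ, fun g hg => (h g).1 hg⟩
  have hf : ∀ g, f (π g) = ρ g := fun g =>
    π.liftOfRightInverse_comp_apply _ (Function.rightInverse_surjInv hπ) ⟨ρ, _⟩ g
  refine ⟨f, (injective_iff_map_eq_one f).2 fun x hx => ?_, hf⟩
  obtain ⟨g, rfl⟩ := hπ x
  rw [hf] at hx
  exact (h g).2 hx

theorem nonempty_mulEquiv_of_ker_eq {F G H : Type*} [Group F] [Group G] [Group H]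
    {π : F →* G} (hπ : Function.Surjective π) {ρ : F →* H} (hρ : Function.Surjective ρ)
    (h : ∀ g, π g = 1 ↔ ρ g = 1) : Nonempty (G ≃* H) := by
  obtain ⟨f, hf, hfπ⟩ := exists_injective_hom_of_ker_eq hπ h
  refine ⟨MulEquiv.ofBijective f ⟨hf, fun y => ?_⟩⟩
  obtain ⟨g, rfl⟩ := hρ y
  exact ⟨π g, hfπ g⟩

theorem ev_eq_of_zpow_eq_one {l : ℂ} {h0 : l ≠ 0} {p q : ℤ} (hq : l ^ q = 1) (P : Laurent2) :
    ev l h0 p q P = ev l h0 p 0 P := by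
  rw [evT_zpow l h0 hq, evT_zpow l h0 (zpow_zero l)]

theorem mem_idealOf_iff_ev {l : ℂ} {h0 : l ≠ 0} (hfin : IsOfFinOrder l) (P : Laurent2) :
    P ∈ idealOf l ↔ ev l h0 1 0 P = 0 :=
  mem_idealOf_iff_of_isOfFinOrder h0 hfin P

open Classical in
/-- The order of `l` if it is finite, and `1` otherwise. -/
def stepOf (l : ℂ) : ℤ := if IsOfFinOrder l then orderOf l else 1

theorem stepOf_ne_zero (l : ℂ) : stepOf l ≠ 0 := by
  rw [stepOf]
  split_ifs with h
  · exact_mod_cast h.orderOf_pos.ne'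
  · exact one_ne_zero

theorem zpow_stepOf_mul {l : ℂ} (h : IsOfFinOrder l) (z : ℤ) : l ^ (stepOf l * z) = 1 := by
  rw [stepOf, if_pos h, zpow_mul, zpow_natCast, pow_orderOf_eq_one, one_zpow]

/-- For a root of unity `y` is evaluated at `1` for every `z`, and a single `z` suffices. Otherwise
the step is `1` and infinitely many values are needed. -/
theorem mem_idealOf_of_infinite_stepOf {l : ℂ} {h0 : l ≠ 0} {P : Laurent2}
    (h : {z : ℤ | ev l h0 1 (stepOf l * z) P = 0}.Infinite) : P ∈ idealOf l := by
  by_cases hfin : IsOfFinOrder l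
  · obtain ⟨z, hz⟩ := h.nonempty
    rw [mem_idealOf_iff_ev (h0 := h0) hfin, ← ev_eq_of_zpow_eq_one (zpow_stepOf_mul hfin z)]
    exact hz
  · refine mem_idealOf_of_infinite (h0 := h0) hfin h fun z hz => ?_
    rw [Set.mem_ofPred_eq, stepOf, if_neg hfin, one_mul] at hz
    exact hz

theorem ev_stepOf_of_mem_idealOf {l : ℂ} {h0 : l ≠ 0} {P : Laurent2} (hP : P ∈ idealOf l)
    (z : ℤ) : ev l h0 1 (stepOf l * z) P = 0 := by
  by_cases hfin : IsOfFinOrder l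
  · rw [ev_eq_of_zpow_eq_one (zpow_stepOf_mul hfin z)]
    exact (mem_idealOf_iff_ev hfin P).1 hP
  · exact ev_eq_zero_of_mem_idealOf h0 hfin _ hP

/-- The projection of the free metabelian group to `M(l)`. -/
def projM (l : ℂ) : FreeMetab2 →* MGroup l := QuotientGroup.mk' (idealSubgroup (idealOf l))

theorem projM_surjective (l : ℂ) : Function.Surjective (projM l) := QuotientGroup.mk'_surjective _

/-! ### The epimorphisms `phi z` and the word problem in `M(l)` -/

section Phi

variable {l : ℂ} {h0 : l ≠ 0}

theorem lc_genT_zpow (k : ℤ) : lc (genT l h0 ^ k) = 0 := by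
  have : genT l h0 ^ k = SemidirectProduct.inr (Multiplicative.ofAdd 1 ^ k) := by
    rw [map_zpow]; rfl
  rw [this]; rfl

variable (l h0) in
/-- The homomorphism with `a ↦ t` and `b ↦ e t ^ (m z)`, where `m = stepOf l`. -/
def phi (z : ℤ) : FreeMetab2 →* GGroup l h0 :=
  metabHom derivedSeries_GGroup (genT l h0) (genE l h0 * genT l h0 ^ (stepOf l * z))

@[simp] theorem phi_genA (z : ℤ) : phi l h0 z genA = genT l h0 := metabHom_genA _ _ _

@[simp] theorem phi_genB (z : ℤ) :
    phi l h0 z genB = genE l h0 * genT l h0 ^ (stepOf l * z) := metabHom_genB _ _ _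

@[simp] theorem tx_phi_genB (z : ℤ) : tx (phi l h0 z genB) = stepOf l * z := by
  rw [phi_genB, tx_mul, tx_zpow]; simp

@[simp] theorem lc_phi_genB (z : ℤ) : lc (phi l h0 z genB) = 1 := by
  rw [phi_genB, lc_mul, lc_genT_zpow]; simp

@[simp] theorem lc_phi_commC (z : ℤ) : lc (phi l h0 z commC) = l - 1 := by
  rw [coe_commC, map_commutatorElement, lc_commutator, lc_phi_genB, phi_genA, lc_genT, tx_genT]
  simp

theorem phi_surjective (z : ℤ) : Function.Surjective (phi l h0 z) := by
  rw [← MonoidHom.range_eq_top, eq_top_iff, ← closure_genT_genE, Subgroup.closure_le]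
  have hT : genT l h0 ∈ (phi l h0 z).range := ⟨genA, phi_genA z⟩
  rintro g (rfl | rfl)
  · exact hT
  · have hB : phi l h0 z genB ∈ (phi l h0 z).range := ⟨genB, rfl⟩
    rw [phi_genB] at hB
    exact (Subgroup.mul_mem_cancel_right _ (Subgroup.zpow_mem _ hT _)).1 hB

theorem phi_eq_one_iff (h1 : l ≠ 1) (z : ℤ) (g : FreeMetab2) :
    phi l h0 z g = 1 ↔ expA g + stepOf l * z * expB g = 0 ∧
      ev l h0 1 (stepOf l * z) (commPoly g) = 0 := by
  rw [hom_eq_one_iff _ (by rw [lc_phi_commC]; exact sub_ne_zero.2 h1)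
    (by rw [phi_genA, tx_genT, zpow_one]; exact h1), tx_phi_genB, phi_genA, tx_genT, one_mul]

theorem phi_eq_one_of_mem_idealSubgroup {g : FreeMetab2} (hg : g ∈ idealSubgroup (idealOf l))
    (z : ℤ) : phi l h0 z g = 1 := by
  refine Subgroup.normalClosure_le_normal (N := (phi l h0 z).ker) ?_ hg
  rintro _ ⟨P, hP, rfl⟩
  change phi l h0 z (commPow P) = 1
  rw [eq_one_iff_lc_tx, tx_hom_of_mem_commutator _ (commPow P).2, lc_hom_commPow, phi_genA,
    tx_genT, tx_phi_genB, ev_stepOf_of_mem_idealOf hP, zero_mul]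
  simp

theorem of_infinite_phi_eq_one (h1 : l ≠ 1) {g : FreeMetab2}
    (h : {z : ℤ | phi l h0 z g = 1}.Infinite) :
    expA g = 0 ∧ expB g = 0 ∧ commPoly g ∈ idealOf l := by
  -- Two different values of `z` already force both exponents to vanish; the polynomial condition
  -- uses all of them.
  obtain ⟨z, hz, w, hw, hzw⟩ := h.nontrivial
  have hz' := ((phi_eq_one_iff h1 z g).1 hz).1
  have hw' := ((phi_eq_one_iff h1 w g).1 hw).1
  have hB : expB g = 0 := by
    have : stepOf l * ((z - w) * expB g) = 0 := by linear_combination hz' - hw'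
    simpa [stepOf_ne_zero, sub_ne_zero.2 hzw] using this
  refine ⟨by simpa [hB] using hz', hB, mem_idealOf_of_infinite_stepOf (h0 := h0) ?_⟩
  exact h.mono fun z hz => ((phi_eq_one_iff h1 z g).1 hz).2

theorem projM_eq_one_iff (h0 : l ≠ 0) (h1 : l ≠ 1) (g : FreeMetab2) :
    projM l g = 1 ↔ expA g = 0 ∧ expB g = 0 ∧ commPoly g ∈ idealOf l := by
  constructor
  · intro hg
    refine of_infinite_phi_eq_one (h0 := h0) h1 (Set.infinite_univ.mono fun z _ => ?_)
    exact phi_eq_one_of_mem_idealSubgroup ((QuotientGroup.eq_one_iff g).1 hg) z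
  · rintro ⟨hA, hB, hP⟩
    -- The assumption concerns a polynomial representing `[a, c^P]`, morally `(x - 1) P`. The factor
    -- `x - 1` is removed by evaluating, since its value `l - 1` is nonzero.
    obtain ⟨P, rfl⟩ := exists_commPow_eq (mem_commutator_iff.2 ⟨hA, hB⟩)
    refine (QuotientGroup.eq_one_iff _).2 (Subgroup.subset_normalClosure ⟨P, ?_, rfl⟩)
    refine mem_idealOf_of_infinite_stepOf (h0 := h0) (Set.infinite_univ.mono fun z _ => ?_)
    have h2 : phi l h0 z (commPow P) = 1 :=
      (phi_eq_one_iff h1 z _).2 ⟨by rw [hA, hB]; simp, ev_stepOf_of_mem_idealOf hP z⟩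
    rw [hom_commPow_eq_one_iff _ (by rw [lc_phi_commC]; exact sub_ne_zero.2 h1), phi_genA,
      tx_genT, tx_phi_genB] at h2
    exact h2

variable (l h0) in
/-- The homomorphism from `M(l)` to `G(l)` that is induced by `phi`. -/
def phiM (z : ℤ) : MGroup l →* GGroup l h0 :=
  QuotientGroup.lift _ (phi l h0 z) fun _ hg => phi_eq_one_of_mem_idealSubgroup hg z

theorem phiM_projM (z : ℤ) (g : FreeMetab2) : phiM l h0 z (projM l g) = phi l h0 z g := rfl

theorem phiM_surjective (z : ℤ) : Function.Surjective (phiM l h0 z) := by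
  intro y
  obtain ⟨g, rfl⟩ := phi_surjective z y
  exact ⟨projM l g, rfl⟩

theorem eq_one_of_infinite_phiM (h1 : l ≠ 1) {x : MGroup l}
    (h : {z : ℤ | phiM l h0 z x = 1}.Infinite) : x = 1 := by
  obtain ⟨g, rfl⟩ := projM_surjective l x
  exact (projM_eq_one_iff h0 h1 g).2 (of_infinite_phi_eq_one h1 h)

theorem phi_zero_eq_one_iff (h1 : l ≠ 1) (g : FreeMetab2) :
    phi l h0 0 g = 1 ↔ expA g = 0 ∧ ev l h0 1 0 (commPoly g) = 0 := by
  rw [phi_eq_one_iff h1]; simp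

theorem derivedSeries_MGroup : derivedSeries (MGroup l) 2 = ⊥ :=
  derivedSeries_of_surjective (projM_surjective l) derivedSeries_freeMetab2

/-! ### Comparison of `M(l)` with `G(l)` -/

variable (h0) in
-- The copy of `G(l)` is generated by `a` and `c`. Every `phiM z` sends this pair to elements of
-- exponents `1` and `0`, so its kernel on words is that of `phi 0`, whatever `z` is.
theorem exists_injective_GGroup_MGroup (h1 : l ≠ 1) :
    ∃ f : GGroup l h0 →* MGroup l, Function.Injective f := by
  let σ : FreeMetab2 →* MGroup l :=
    metabHom derivedSeries_MGroup (projM l genA) (projM l commC)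
  suffices hker : ∀ g, phi l h0 0 g = 1 ↔ σ g = 1 by
    obtain ⟨f, hf, -⟩ := exists_injective_hom_of_ker_eq (phi_surjective 0) hker
    exact ⟨f, hf⟩
  intro g
  have key : ∀ z, phiM l h0 z (σ g) = 1 ↔ phi l h0 0 g = 1 := by
    intro z
    let χ : FreeMetab2 →* GGroup l h0 := (phiM l h0 z).comp σ
    have hA : χ genA = genT l h0 := by simp [χ, σ, phiM_projM]
    have hB : χ genB = phi l h0 z commC := by simp [χ, σ, phiM_projM]
    have htB : tx (χ genB) = 0 := by
      rw [hB, coe_commC, map_commutatorElement, tx_commutator]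
    have hC : lc (χ commC) ≠ 0 := by
      rw [coe_commC, map_commutatorElement, lc_commutator, hA, hB, lc_phi_commC, lc_genT,
        mul_zero, sub_zero, tx_genT, zpow_one]
      exact mul_ne_zero (sub_ne_zero.2 h1) (sub_ne_zero.2 h1)
    rw [phi_zero_eq_one_iff h1]
    change χ g = 1 ↔ _
    rw [hom_eq_one_iff χ hC (by rw [hA, tx_genT, zpow_one]; exact h1), htB, hA, tx_genT]
    simp
  constructor
  · intro hg
    exact eq_one_of_infinite_phiM (h0 := h0) h1 (Set.infinite_univ.mono fun z _ => (key z).2 hg)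
  · intro hg
    rw [← key 0, hg, map_one]

variable (h0) in
-- A nontrivial element of `M(l)` dies under `phiM z` for finitely many `z` only, so `M(l)` is a
-- limit of `G(l)` along a nonprincipal ultrafilter on `ℤ`.
theorem universalTheory_MGroup (h1 : l ≠ 1) :
    universalTheory (MGroup l) = universalTheory (GGroup l h0) := by
  apply Set.Subset.antisymm
  · obtain ⟨f, hf⟩ := exists_injective_GGroup_MGroup h0 h1
    exact universalTheory_subset_of_injective f hf
  · refine universalTheory_subset_of_limit (hyperfilter ℤ) (phiM l h0) fun x hx => ?_
    rw [Ultrafilter.eventually_not]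
    intro hev
    refine hx (eq_one_of_infinite_phiM (h0 := h0) h1 fun hfin => ?_)
    exact Set.Finite.notMem_hyperfilter hfin hev

theorem not_injective_phiM_zero (h1 : l ≠ 1) : ¬ Function.Injective (phiM l h0 0) := by
  intro hinj
  have hker : ∀ g, phi l h0 0 g = 1 → projM l g = 1 := fun g hg =>
    (injective_iff_map_eq_one _).1 hinj _ hg
  by_cases hfin : IsOfFinOrder l
  · have hspec := isIntMinpoly_cyclotomic hfin
    set P := cyclotomic (orderOf l) ℤ with hP
    obtain ⟨Q, hQ⟩ := X_sub_C_dvd_sub_C_eval (a := 1) (p := P)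
    have hN : P.eval 1 ≠ 0 := by
      intro hN
      have : aeval (1 : ℂ) (intMinpoly l) = 0 := by
        rw [hspec.intMinpoly_eq, ← map_one (algebraMap ℤ ℂ), aeval_algebraMap_apply,
          coe_aeval_eq_eval, hN, map_zero]
      exact ne_one_of_intMinpoly_eq h1 (intMinpoly_eq_of_aeval_eq_zero hspec.isAlgebraic this) rfl
    have hQl : ((P.eval 1 : ℤ) : ℂ) + (l - 1) * aeval l Q = 0 := by
      have h := congrArg (aeval l) hQ
      rw [map_sub, hspec.2.1, map_mul] at h
      simp at h
      linear_combination -h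
    -- With `Φ_m = Φ_m(1) + (X - 1) Q`, the element `b^(Φ_m(1)) c^(Q(x))` has component `Φ_m(1) + (l
    -- - 1) Q(l) = Φ_m(l) = 0` under `phi 0`, while its `b`-exponent `Φ_m(1)` is nonzero because `l
    -- ≠ 1`.
    have hg := hker (genB ^ P.eval 1 * commPow (aeval varX Q)) (by
      rw [eq_one_iff_lc_tx, map_mul, lc_mul, tx_mul, map_zpow, tx_zpow,
        tx_hom_of_mem_commutator _ (commPow _).2, lc_hom_commPow, phi_genA, tx_genT,
        ev_aeval_varX, tx_phi_genB, lc_phi_commC, phi_genB]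
      have : ∀ n : ℤ, lc (genE l h0 ^ n) = n := by
        intro n
        have : genE l h0 ^ n = SemidirectProduct.inl (Multiplicative.ofAdd 1 ^ n) := by
          rw [map_zpow]; rfl
        rw [this, ← ofAdd_zsmul]
        change (((n • 1 : laurentRing l)) : ℂ) = _
        simp
      simp only [mul_zero, zpow_zero, mul_one, this]
      refine ⟨?_, by simp⟩
      rw [zpow_one]
      linear_combination hQl)
    have h2 := ((projM_eq_one_iff h0 h1 _).1 hg).2.1
    rw [expB_mul, expB_zpow, expB_genB, (mem_commutator_iff.1 (commPow _).2).2] at h2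
    exact hN (by linarith)
  -- Under `phi 0` both `b` and `c` land in the abelian normal subgroup, so `[b, c]` dies; under
  -- `phi 1` its component is `(l - 1)^2`.
  · have hg := hker ⁅genB, (commC : FreeMetab2)⁆ (by
      rw [eq_one_iff_lc_tx, map_commutatorElement, tx_commutator, lc_commutator, tx_phi_genB,
        tx_hom_of_mem_commutator _ commC.2]
      simp)
    have h2 : phi l h0 1 ⁅genB, (commC : FreeMetab2)⁆ = 1 := by
      rw [← phiM_projM, hg, map_one]
    rw [eq_one_iff_lc_tx, map_commutatorElement, lc_commutator, tx_phi_genB,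
      tx_hom_of_mem_commutator _ commC.2, lc_phi_commC, stepOf, if_neg hfin] at h2
    simp [sub_eq_zero, h1] at h2

end Phi

/-! ### Automorphisms of the free metabelian group -/

theorem expA_hom (θ : FreeMetab2 →* FreeMetab2) (g : FreeMetab2) :
    expA (θ g) = expA g * expA (θ genA) + expB g * expA (θ genB) := by
  have h := congrArg (fun z => z.toAdd.1) (hom_apply_eq (expo.comp θ) g)
  simpa [expA] using h

theorem expB_hom (θ : FreeMetab2 →* FreeMetab2) (g : FreeMetab2) :
    expB (θ g) = expA g * expB (θ genA) + expB g * expB (θ genB) := by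
  have h := congrArg (fun z => z.toAdd.2) (hom_apply_eq (expo.comp θ) g)
  simpa [expB] using h

/-- The automorphism given by an endomorphism and its inverse. -/
def metabEquiv (f g : FreeMetab2 →* FreeMetab2) (h1 : g (f genA) = genA) (h2 : g (f genB) = genB)
    (h3 : f (g genA) = genA) (h4 : f (g genB) = genB) : FreeMetab2 ≃* FreeMetab2 :=
  MonoidHom.toMulEquiv f g (metab_hom_ext h1 h2) (metab_hom_ext h3 h4)

/-- The automorphism `a ↦ b`, `b ↦ a b ^ k`. -/
def swapShear (k : ℤ) : FreeMetab2 ≃* FreeMetab2 :=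
  metabEquiv (metabHom derivedSeries_freeMetab2 genB (genA * genB ^ k))
    (metabHom derivedSeries_freeMetab2 (genB * genA ^ (-k)) genA)
    (by rw [metabHom_genA, metabHom_genB])
    (by rw [metabHom_genB, map_mul, map_zpow, metabHom_genA, metabHom_genB, zpow_neg,
      inv_mul_cancel_right])
    (by rw [metabHom_genA, map_mul, map_zpow, metabHom_genA, metabHom_genB, zpow_neg,
      mul_inv_cancel_right])
    (by rw [metabHom_genB, metabHom_genA])

@[simp] theorem swapShear_genA (k : ℤ) : swapShear k genA = genB :=
  metabHom_genA derivedSeries_freeMetab2 genB (genA * genB ^ k)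

@[simp] theorem swapShear_genB (k : ℤ) : swapShear k genB = genA * genB ^ k :=
  metabHom_genB derivedSeries_freeMetab2 genB (genA * genB ^ k)

/-- The automorphism `a ↦ a⁻¹`, `b ↦ b`. -/
def invertA : FreeMetab2 ≃* FreeMetab2 :=
  metabEquiv (metabHom derivedSeries_freeMetab2 genA⁻¹ genB)
    (metabHom derivedSeries_freeMetab2 genA⁻¹ genB)
    (by rw [metabHom_genA, map_inv, metabHom_genA, inv_inv])
    (by rw [metabHom_genB, metabHom_genB])
    (by rw [metabHom_genA, map_inv, metabHom_genA, inv_inv])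
    (by rw [metabHom_genB, metabHom_genB])

@[simp] theorem invertA_genA : invertA genA = genA⁻¹ :=
  metabHom_genA derivedSeries_freeMetab2 genA⁻¹ genB

@[simp] theorem invertA_genB : invertA genB = genB :=
  metabHom_genB derivedSeries_freeMetab2 genA⁻¹ genB

/-- The automorphism `a ↦ a`, `b ↦ b a ^ k`. -/
def shear (k : ℤ) : FreeMetab2 ≃* FreeMetab2 :=
  metabEquiv (metabHom derivedSeries_freeMetab2 genA (genB * genA ^ k))
    (metabHom derivedSeries_freeMetab2 genA (genB * genA ^ (-k)))
    (by rw [metabHom_genA, metabHom_genA])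
    (by rw [metabHom_genB, map_mul, map_zpow, metabHom_genA, metabHom_genB, zpow_neg,
      inv_mul_cancel_right])
    (by rw [metabHom_genA, metabHom_genA])
    (by rw [metabHom_genB, map_mul, map_zpow, metabHom_genA, metabHom_genB, zpow_neg,
      mul_inv_cancel_right])

@[simp] theorem shear_genA (k : ℤ) : shear k genA = genA :=
  metabHom_genA derivedSeries_freeMetab2 genA (genB * genA ^ k)

@[simp] theorem shear_genB (k : ℤ) : shear k genB = genB * genA ^ k :=
  metabHom_genB derivedSeries_freeMetab2 genA (genB * genA ^ k)

/-- Euclid's algorithm on the exponent vector, realised by automorphisms. -/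
theorem exists_aut_expB_eq_zero (g : FreeMetab2) :
    ∃ α : FreeMetab2 ≃* FreeMetab2, expB (α g) = 0 ∧ 0 ≤ expA (α g) := by
  induction hn : (expB g).natAbs using Nat.strong_induction_on generalizing g with
  | _ n ih =>
  by_cases hB : expB g = 0
  · by_cases hA : 0 ≤ expA g
    · exact ⟨MulEquiv.refl _, hB, hA⟩
    · refine ⟨invertA, ?_, ?_⟩
      · have := expB_hom invertA.toMonoidHom g
        simp [hB] at this
        exact this
      · have := expA_hom invertA.toMonoidHom g
        simp [hB] at this
        rw [this]
        omega
  · have h2 : expB (swapShear (-(expA g / expB g)) g) = expA g % expB g := by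
      have := expB_hom (swapShear (-(expA g / expB g))).toMonoidHom g
      simp at this
      rw [this, Int.emod_def]
      ring
    obtain ⟨α, hα⟩ := ih (expA g % expB g).natAbs (by
      rw [← hn]
      have h3 := Int.emod_lt_abs (expA g) hB
      have h4 := Int.emod_nonneg (expA g) hB
      zify
      rwa [abs_of_nonneg h4]) (swapShear (-(expA g / expB g)) g) (by rw [h2])
    exact ⟨(swapShear (-(expA g / expB g))).trans α, hα⟩

/-! ### Limits of `G(l)` -/

/-- The epimorphism `π` to a non-abelian group is the limit of the homomorphisms `ψ n` to `G(l)`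
along an ultrafilter. -/
structure IsLimit {l : ℂ} {h0 : l ≠ 0} {G ι : Type*} [Group G] (U : Ultrafilter ι)
    (π : FreeMetab2 →* G) (ψ : ι → FreeMetab2 →* GGroup l h0) : Prop where
  surjective : Function.Surjective π
  nonabelian : ∃ x y : G, x * y ≠ y * x
  eq_one_iff : ∀ g, π g = 1 ↔ ∀ᶠ n in (U : Filter ι), ψ n g = 1

/-- Eventually, `ψ n g` acts on `ℤ[l, l⁻¹]` by a root of the minimal polynomial of `l`. -/
def ActsConj {l : ℂ} {h0 : l ≠ 0} {ι : Type*} (U : Ultrafilter ι)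
    (ψ : ι → FreeMetab2 →* GGroup l h0) (g : FreeMetab2) : Prop :=
  ∀ᶠ n in (U : Filter ι), aeval (l ^ tx (ψ n g)) (intMinpoly l) = 0

section Limit

variable {l : ℂ} {h0 : l ≠ 0} {G ι : Type*} [Group G] {U : Ultrafilter ι}
  {π : FreeMetab2 →* G} {ψ : ι → FreeMetab2 →* GGroup l h0}

theorem IsLimit.comp (h : IsLimit U π ψ) (α : FreeMetab2 ≃* FreeMetab2) :
    IsLimit U (π.comp α.toMonoidHom) (fun n => (ψ n).comp α.toMonoidHom) where
  surjective := h.surjective.comp α.surjective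
  nonabelian := h.nonabelian
  eq_one_iff g := h.eq_one_iff (α g)

theorem ActsConj.comp {g : FreeMetab2} (h : ActsConj U ψ g) (α : FreeMetab2 ≃* FreeMetab2) :
    ActsConj U (fun n => (ψ n).comp α.toMonoidHom) (α.symm g) := by
  filter_upwards [h] with n hn
  simpa using hn

theorem IsLimit.ne_one (h : IsLimit U π ψ) {g : FreeMetab2} (hg : π g ≠ 1) :
    ∀ᶠ n in (U : Filter ι), ψ n g ≠ 1 := by
  rw [Ultrafilter.eventually_not, ← h.eq_one_iff]
  exact hg

theorem lc_ne_zero_of_mem_commutator {χ : FreeMetab2 →* GGroup l h0} {g : FreeMetab2}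
    (hg : g ∈ commutator FreeMetab2) (h : χ g ≠ 1) : lc (χ g) ≠ 0 := fun h1 =>
  h (eq_one_iff_lc_tx.2 ⟨h1, tx_hom_of_mem_commutator χ hg⟩)

theorem IsLimit.lc_commC_ne_zero (h : IsLimit U π ψ) :
    ∀ᶠ n in (U : Filter ι), lc (ψ n commC) ≠ 0 := by
  have hc : π commC ≠ 1 := by
    intro hc
    obtain ⟨x, y, hxy⟩ := h.nonabelian
    refine hxy (commute_of_closure_pair (closure_map_pair h.surjective) ?_ x y)
    rwa [coe_commC, map_commutatorElement, commutatorElement_eq_one_iff_mul_comm] at hc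
  filter_upwards [h.ne_one hc] with n hn using lc_ne_zero_of_mem_commutator commC.2 hn

/-- Eventually `ψ n` has exponents `(p, 0)` with `l^p` conjugate to `l`, so its kernel is that of
`phi 0`. -/
theorem nonempty_mulEquiv_GGroup (h1 : l ≠ 1) (h : IsLimit U π ψ)
    (hB : ∀ᶠ n in (U : Filter ι), tx (ψ n genB) = 0)
    (hA : ∀ᶠ n in (U : Filter ι), intMinpoly (l ^ tx (ψ n genA)) = intMinpoly l) :
    Nonempty (G ≃* GGroup l h0) := by
  refine nonempty_mulEquiv_of_ker_eq h.surjective (phi_surjective 0) fun g => ?_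
  rw [h.eq_one_iff, ← eventually_const (p := phi l h0 0 g = 1) (f := (U : Filter ι))]
  refine eventually_congr ?_
  filter_upwards [hA, hB, h.lc_commC_ne_zero] with n hnA hnB hnC
  have hl := ne_one_of_intMinpoly_eq h1 hnA
  have hp : tx (ψ n genA) ≠ 0 := by
    intro hp
    rw [hp, zpow_zero] at hl
    exact hl rfl
  have hev : ev l h0 1 0 (commPoly g) = evT l h0 (substT 1 0 (commPoly g)) := rfl
  rw [hom_eq_one_iff _ hnC hl, phi_zero_eq_one_iff h1, hnB, evT_zpow l h0 (zpow_zero l), hev,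
    evT_eq_zero_iff, evT_eq_zero_iff, hnA]
  simp [hp]

/-- By `hne` and `hI`, the condition for an element to die in the limit is the one that
`projM_eq_one_iff` gives for `M(l)`. -/
theorem nonempty_mulEquiv_MGroup (h1 : l ≠ 1) (h : IsLimit U π ψ)
    (hA : ∀ᶠ n in (U : Filter ι), intMinpoly (l ^ tx (ψ n genA)) = intMinpoly l)
    (hne : ∀ g, (∀ᶠ n in (U : Filter ι), tx (ψ n g) = 0) → expA g = 0 ∧ expB g = 0)
    (hI : ∀ Q, (∀ᶠ n in (U : Filter ι), ev l h0 (tx (ψ n genA)) (tx (ψ n genB)) Q = 0) ↔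
      Q ∈ idealOf l) :
    Nonempty (G ≃* MGroup l) := by
  refine nonempty_mulEquiv_of_ker_eq h.surjective (projM_surjective l) fun g => ?_
  rw [h.eq_one_iff, projM_eq_one_iff h0 h1, ← hI, ← and_assoc]
  have key : ∀ᶠ n in (U : Filter ι), (ψ n g = 1 ↔ tx (ψ n g) = 0 ∧
      ev l h0 (tx (ψ n genA)) (tx (ψ n genB)) (commPoly g) = 0) := by
    filter_upwards [hA, h.lc_commC_ne_zero] with n hnA hnC
    rw [hom_eq_one_iff _ hnC (ne_one_of_intMinpoly_eq h1 hnA), ← tx_hom]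
  rw [eventually_congr key, eventually_and]
  refine and_congr_left fun _ => ⟨hne g, fun hg => Eventually.of_forall fun n => ?_⟩
  rw [tx_hom, hg.1, hg.2, mul_zero, mul_zero, add_zero]

/-- The system `c ≠ 1`, `c^(P_l(x)) = 1` is solved in `G(l)` by `t`, `e`, hence has a solution in
`G`. Applying `ψ n` to a lift `u` of its first entry gives `P_l(l^k) = 0`, where `k` is the exponent
of `ψ n u`. -/
theorem exists_actsConj (h1 : l ≠ 1) (h : IsLimit U π ψ)
    (hT : universalTheory G ⊆ universalTheory (GGroup l h0)) : ∃ u, ActsConj U ψ u := by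
  let mk : FreeGroup (Fin 2) →* FreeMetab2 := QuotientGroup.mk' _
  obtain ⟨wc, hwc⟩ : ∃ w, mk w = commC := QuotientGroup.mk'_surjective _ _
  obtain ⟨wP, hwP⟩ : ∃ w, mk w = commPow (aeval varX (intMinpoly l)) :=
    QuotientGroup.mk'_surjective _ _
  classical
  obtain ⟨χ, hχ⟩ := exists_hom_of_universalTheory_subset hT ((phi l h0 0).comp mk) {wc, wP}
  obtain ⟨u, hu⟩ := h.surjective (χ (FreeGroup.of 0))
  obtain ⟨v, hv⟩ := h.surjective (χ (FreeGroup.of 1))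
  let θ : FreeMetab2 →* FreeMetab2 := metabHom derivedSeries_freeMetab2 u v
  have hθ : χ = (π.comp θ).comp mk := by
    ext i
    fin_cases i
    · change _ = π (θ genA)
      exact (congrArg π (metabHom_genA _ _ _)).trans hu |>.symm
    · change _ = π (θ genB)
      exact (congrArg π (metabHom_genB _ _ _)).trans hv |>.symm
  have hc : π (θ commC) ≠ 1 := by
    have := (hχ wc (by simp)).not.2 (by
      rw [MonoidHom.comp_apply, hwc, eq_one_iff_lc_tx, lc_phi_commC]
      exact fun h2 => sub_ne_zero.2 h1 h2.1)
    rwa [hθ, MonoidHom.comp_apply, hwc] at this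
  have hP : π (θ (commPow (aeval varX (intMinpoly l)))) = 1 := by
    have := (hχ wP (by simp)).2 (by
      rw [MonoidHom.comp_apply, hwP, hom_commPow_eq_one_iff _
        (by rw [lc_phi_commC]; exact sub_ne_zero.2 h1), ev_aeval_varX, phi_genA, tx_genT, zpow_one,
        aeval_intMinpoly])
    rwa [hθ, MonoidHom.comp_apply, hwP] at this
  refine ⟨u, ?_⟩
  filter_upwards [h.ne_one hc, (h.eq_one_iff _).1 hP] with n hn1 hn2
  have h3 := (hom_commPow_eq_one_iff ((ψ n).comp θ) (lc_ne_zero_of_mem_commutator commC.2 hn1) _).1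
    hn2
  rwa [ev_aeval_varX, MonoidHom.comp_apply, metabHom_genA] at h3

end Limit

/-! ### Classification of the limits of `G(l)` -/

theorem exists_eventually_eq_of_finite {ι β : Type*} [Finite β] (U : Ultrafilter ι)
    (f : ι → β) : ∃ b, ∀ᶠ n in (U : Filter ι), f n = b :=
  Ultrafilter.eventually_exists_iff.1 (Eventually.of_forall fun n => ⟨f n, rfl⟩)

theorem exists_aut_expA_eq_zero (g : FreeMetab2) :
    ∃ α : FreeMetab2 ≃* FreeMetab2, expA (α g) = 0 := by
  obtain ⟨α, hα, -⟩ := exists_aut_expB_eq_zero g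
  refine ⟨α.trans (swapShear 0), ?_⟩
  have := expA_hom (swapShear 0).toMonoidHom (α g)
  simp [hα] at this
  exact this

theorem expB_ne_zero_of_aut {g : FreeMetab2} (hg : ¬ (expA g = 0 ∧ expB g = 0))
    {α : FreeMetab2 ≃* FreeMetab2} (hα : expA (α g) = 0) : expB (α g) ≠ 0 := by
  intro hB
  apply hg
  have h1 := expA_hom α.symm.toMonoidHom (α g)
  have h2 := expB_hom α.symm.toMonoidHom (α g)
  rw [hα, hB] at h1 h2
  simpa using And.intro h1 h2

section Limit

variable {l : ℂ} {h0 : l ≠ 0} {G ι : Type*} [Group G] {U : Ultrafilter ι}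
  {π : FreeMetab2 →* G} {ψ : ι → FreeMetab2 →* GGroup l h0}

theorem zpow_eq_of_isOfFinOrder {p q : ℤ} (hl : IsOfFinOrder l)
    (hpq : (p : ZMod (orderOf l)) = q) : l ^ p = l ^ q := by
  have h0 : l ≠ 0 := by
    rintro rfl
    have := pow_orderOf_eq_one (0 : ℂ)
    rw [zero_pow hl.orderOf_pos.ne'] at this
    exact zero_ne_one this
  rw [ZMod.intCast_eq_intCast_iff_dvd_sub] at hpq
  obtain ⟨k, hk⟩ := hpq
  have : q = p + orderOf l * k := by linarith
  rw [this, zpow_add₀ h0, zpow_mul, zpow_natCast, pow_orderOf_eq_one, one_zpow, mul_one]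

theorem IsLimit.eventually_ne_zero_or (h : IsLimit U π ψ) :
    ∀ᶠ n in (U : Filter ι), ¬ (tx (ψ n genA) = 0 ∧ tx (ψ n genB) = 0) := by
  filter_upwards [h.lc_commC_ne_zero] with n hn hpq
  apply hn
  rw [coe_commC, map_commutatorElement, lc_commutator, hpq.1, hpq.2]
  simp

/-- A power of `l^p` has exact order `m`, and `l^p` is itself an `m`-th root of unity, so it is
primitive. -/
theorem intMinpoly_zpow_eq_of_isOfFinOrder (hfin : IsOfFinOrder l) {p k : ℤ}
    (h : aeval ((l ^ p) ^ k) (intMinpoly l) = 0) : intMinpoly (l ^ p) = intMinpoly l := by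
  have hm := hfin.orderOf_pos
  have hspec := isIntMinpoly_cyclotomic hfin
  refine intMinpoly_eq_of_aeval_eq_zero hspec.isAlgebraic ?_
  rw [hspec.intMinpoly_eq] at h ⊢
  have h1 := isPrimitiveRoot_of_aeval_cyclotomic hm h
  have h2 : IsPrimitiveRoot (l ^ p) (orderOf l) := by
    refine ⟨?_, fun j hj => h1.dvd_of_pow_eq_one j ?_⟩
    · rw [← zpow_natCast, zpow_comm, zpow_natCast, pow_orderOf_eq_one, one_zpow]
    · rw [← zpow_natCast, zpow_comm, zpow_natCast, hj, one_zpow]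
  have h3 := h2.isRoot_cyclotomic hm
  rw [IsRoot.def, ← map_cyclotomic_int, eval_map] at h3
  exact h3

/-- If the exponents of `ψ n` satisfy a linear relation and `l` is a root of unity or
transcendental, then the limit is `G(l)`. -/
theorem nonempty_mulEquiv_GGroup_of_relation (h1 : l ≠ 1)
    (hl : IsOfFinOrder l ∨ ¬ IsAlgebraic ℤ l) (h : IsLimit U π ψ)
    {u : FreeMetab2} (hu : ActsConj U ψ u) {g : FreeMetab2} (hg : ¬ (expA g = 0 ∧ expB g = 0))
    (htx : ∀ᶠ n in (U : Filter ι), tx (ψ n g) = 0) : Nonempty (G ≃* GGroup l h0) := by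
  -- In the new basis `g` has exponents `(0, r)` with `r ≠ 0`, so the relation says that the second
  -- generator has exponent `0`.
  obtain ⟨α, hα⟩ := exists_aut_expA_eq_zero g
  have hB := expB_ne_zero_of_aut hg hα
  have h' := h.comp α.symm
  have hu' := hu.comp α.symm
  have hq : ∀ᶠ n in (U : Filter ι), tx ((ψ n).comp α.symm.toMonoidHom genB) = 0 := by
    filter_upwards [htx] with n hn
    have h2 := tx_hom ((ψ n).comp α.symm.toMonoidHom) (α g)
    rw [hα, mul_zero, zero_add] at h2
    have h3 : (ψ n).comp α.symm.toMonoidHom (α g) = ψ n g := by simp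
    rw [h3, hn, eq_comm, mul_eq_zero] at h2
    exact h2.resolve_right hB
  refine nonempty_mulEquiv_GGroup h1 h' hq ?_
  filter_upwards [hq, hu', h'.eventually_ne_zero_or] with n hqn hun hne
  rcases hl with hl | hl
  · rw [tx_hom, hqn, zero_mul, add_zero, zpow_mul] at hun
    exact intMinpoly_zpow_eq_of_isOfFinOrder hl hun
  · have hp : tx ((ψ n).comp α.symm.toMonoidHom genA) ≠ 0 := fun hp => hne ⟨hp, hqn⟩
    rw [intMinpoly_of_not_isAlgebraic hl,
      intMinpoly_of_not_isAlgebraic fun h2 => hl (isAlgebraic_of_zpow hp h2)]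

theorem nonempty_mulEquiv_MGroup_of_not_isAlgebraic (h1 : l ≠ 1) (hl : ¬ IsAlgebraic ℤ l)
    (h : IsLimit U π ψ)
    (hne : ∀ g, (∀ᶠ n in (U : Filter ι), tx (ψ n g) = 0) → expA g = 0 ∧ expB g = 0) :
    Nonempty (G ≃* MGroup l) := by
  have hfin : ¬ IsOfFinOrder l := fun hf => hl (isIntMinpoly_cyclotomic hf).isAlgebraic
  refine nonempty_mulEquiv_MGroup h1 h ?_ hne fun Q => ?_
  · have : ∀ᶠ n in (U : Filter ι), ¬ tx (ψ n genA) = 0 := by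
      rw [Ultrafilter.eventually_not]
      intro h2
      simpa using (hne _ h2).1
    filter_upwards [this] with n hp
    rw [intMinpoly_of_not_isAlgebraic hl,
      intMinpoly_of_not_isAlgebraic fun h2 => hl (isAlgebraic_of_zpow hp h2)]
  · rw [idealOf, if_neg hfin, intMinpoly_of_not_isAlgebraic hl, map_zero, Ideal.mem_span_singleton,
      zero_dvd_iff]
    refine ⟨fun hQ => ?_, fun hQ => Eventually.of_forall fun n => by rw [hQ, map_zero]⟩
    -- Two exponents in the finite support with equal images infinitely often would, along the
    -- ultrafilter, be a linear relation excluded by `hne`.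
    have hinj : ∀ᶠ n in (U : Filter ι), ∀ e ∈ Q.coeff.support, ∀ f ∈ Q.coeff.support,
        linForm (tx (ψ n genA)) (tx (ψ n genB)) e = linForm (tx (ψ n genA)) (tx (ψ n genB)) f →
          e = f := by
      simp only [eventually_all_finset]
      intro e _ f _
      by_cases hef : e = f
      · exact Eventually.of_forall fun n _ => hef
      · have : ∀ᶠ n in (U : Filter ι),
            ¬ tx (ψ n (genA ^ (e.1 - f.1) * genB ^ (e.2 - f.2))) = 0 := by
          rw [Ultrafilter.eventually_not]
          intro h2
          have h3 := hne _ h2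
          simp [sub_eq_zero] at h3
          exact hef (Prod.ext h3.1 h3.2)
        filter_upwards [this] with n hn h4
        exfalso
        apply hn
        rw [tx_hom]
        simp at h4 ⊢
        linear_combination h4
    obtain ⟨n, hn1, hn2⟩ := (hQ.and hinj).exists
    exact eq_zero_of_ev_eq_zero_of_not_isAlgebraic hl (fun e he f hf hef =>
      hn2 e (Finset.mem_coe.1 he) f (Finset.mem_coe.1 hf) hef) hn1

theorem nonempty_mulEquiv_MGroup_of_isOfFinOrder (h1 : l ≠ 1) (hl : IsOfFinOrder l)
    (h : IsLimit U π ψ) {u : FreeMetab2} (hu : ActsConj U ψ u)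
    (hne : ∀ g, (∀ᶠ n in (U : Filter ι), tx (ψ n g) = 0) → expA g = 0 ∧ expB g = 0) :
    Nonempty (G ≃* MGroup l) := by
  have : NeZero (orderOf l) := ⟨hl.orderOf_pos.ne'⟩
  obtain ⟨⟨p, q⟩, hpq⟩ := exists_eventually_eq_of_finite U
    fun n => ((tx (ψ n genA) : ZMod (orderOf l)), (tx (ψ n genB) : ZMod (orderOf l)))
  let P : ℤ := p.val
  let R : ℤ := q.val
  -- `P`, `R` are the eventual residues of the two exponents. An automorphism carrying `(R, -P)` to
  -- a multiple of `(0, 1)` makes the new second generator orthogonal to `(P, R)`, so it acts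
  -- trivially on `ℤ[l, l⁻¹]`.
  obtain ⟨α, hα⟩ : ∃ α : FreeMetab2 ≃* FreeMetab2,
      P * expA (α.symm genB) + R * expB (α.symm genB) = 0 := by
    by_cases hPR : P = 0 ∧ R = 0
    · exact ⟨MulEquiv.refl _, by rw [hPR.1, hPR.2]; simp⟩
    · obtain ⟨α, hα⟩ := exists_aut_expA_eq_zero (genA ^ R * genB ^ (-P))
      have hB := expB_ne_zero_of_aut (by simpa [and_comm] using hPR) hα
      refine ⟨α, ?_⟩
      have e1 := expA_hom α.symm.toMonoidHom (α (genA ^ R * genB ^ (-P)))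
      have e2 := expB_hom α.symm.toMonoidHom (α (genA ^ R * genB ^ (-P)))
      rw [hα] at e1 e2
      simp only [MulEquiv.toMonoidHom_eq_coe, MonoidHom.coe_coe, MulEquiv.symm_apply_apply,
        expA_mul, expA_zpow, expA_genA, expA_genB, expB_mul, expB_zpow, expB_genA, expB_genB,
        zero_mul, zero_add, mul_one, mul_zero, add_zero] at e1 e2
      have h2 : expB (α (genA ^ R * genB ^ (-P))) *
          (P * expA (α.symm genB) + R * expB (α.symm genB)) = 0 := by
        linear_combination (-P) * e1 - R * e2
      exact (mul_eq_zero.1 h2).resolve_left hB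
  have h' := h.comp α.symm
  have hu' := hu.comp α.symm
  have hq : ∀ᶠ n in (U : Filter ι), l ^ tx ((ψ n).comp α.symm.toMonoidHom genB) = 1 := by
    filter_upwards [hpq] with n hn
    rw [← zpow_zero l]
    refine zpow_eq_of_isOfFinOrder hl ?_
    have hn1 : (tx (ψ n genA) : ZMod (orderOf l)) = P := by
      exact (congrArg Prod.fst hn).trans (by simp [P])
    have hn2 : (tx (ψ n genB) : ZMod (orderOf l)) = R := by
      exact (congrArg Prod.snd hn).trans (by simp [R])
    rw [← hα]
    change ((tx (ψ n (α.symm genB)) : ℤ) : ZMod (orderOf l)) = _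
    rw [tx_hom]
    push_cast
    rw [hn1, hn2]
  have hp : ∀ᶠ n in (U : Filter ι),
      intMinpoly (l ^ tx ((ψ n).comp α.symm.toMonoidHom genA)) = intMinpoly l := by
    filter_upwards [hq, hu'] with n hqn hun
    rw [tx_hom, zpow_add₀ h0, zpow_mul l (tx ((ψ n).comp α.symm.toMonoidHom genB)), hqn, one_zpow,
      mul_one, zpow_mul] at hun
    exact intMinpoly_zpow_eq_of_isOfFinOrder hl hun
  refine nonempty_mulEquiv_MGroup h1 h' hp (fun g hg => ?_) fun Q => ?_
  · have h2 := hne (α.symm g) hg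
    have e1 := expA_hom α.toMonoidHom (α.symm g)
    have e2 := expB_hom α.toMonoidHom (α.symm g)
    rw [h2.1, h2.2] at e1 e2
    simpa using And.intro e1 e2
  · rw [mem_idealOf_iff_of_isOfFinOrder h0 hl,
      ← eventually_const (p := evT l h0 (substT 1 0 Q) = 0) (f := (U : Filter ι))]
    refine eventually_congr ?_
    filter_upwards [hq, hp] with n hqn hpn
    rw [evT_zpow l h0 hqn, evT_eq_zero_iff, evT_eq_zero_iff, hpn]

/-- The acting element has exponent `±1`, so a change of basis normalises the first exponent to `1`.
The dichotomy is whether the second is constant along the ultrafilter. -/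
theorem nonempty_mulEquiv_of_not_isOfFinOrder (h1 : l ≠ 1) (hfin : ¬ IsOfFinOrder l)
    (halg : IsAlgebraic ℤ l) (h : IsLimit U π ψ) {u : FreeMetab2} (hu : ActsConj U ψ u) :
    Nonempty (G ≃* GGroup l h0) ∨ Nonempty (G ≃* MGroup l) := by
  obtain ⟨u, hu⟩ : ∃ u, ∀ᶠ n in (U : Filter ι), tx (ψ n u) = 1 := by
    have h2 : ∀ᶠ n in (U : Filter ι), tx (ψ n u) = 1 ∨ tx (ψ n u) = -1 := by
      filter_upwards [hu] with n hn
      exact eq_one_or_neg_one_of_aeval_zpow h0 h1 hfin halg hn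
    rcases Ultrafilter.eventually_or.1 h2 with h3 | h3
    · exact ⟨u, h3⟩
    · refine ⟨u⁻¹, ?_⟩
      filter_upwards [h3] with n hn
      rw [map_inv, tx_inv, hn, neg_neg]
  obtain ⟨α, hαB, hαA⟩ := exists_aut_expB_eq_zero u
  have h' := h.comp α.symm
  set ψ' : ι → FreeMetab2 →* GGroup l h0 := fun n => (ψ n).comp α.symm.toMonoidHom with hψ'
  have hp : ∀ᶠ n in (U : Filter ι), tx (ψ' n genA) = 1 := by
    filter_upwards [hu] with n hn
    have h2 := tx_hom (ψ' n) (α u)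
    have h3 : ψ' n (α u) = ψ n u := by simp [hψ']
    rw [hαB, mul_zero, add_zero, h3, hn] at h2
    -- The exponent of `a` divides `1`, and its sign is fixed by `0 ≤ expA (α u)`.
    rcases Int.eq_one_or_neg_one_of_mul_eq_one h2.symm with h4 | h4
    · exact h4
    · rw [h4] at h2; omega
  by_cases hconst : ∃ q, ∀ᶠ n in (U : Filter ι), tx (ψ' n genB) = q
  · left
    obtain ⟨q, hq⟩ := hconst
    refine nonempty_mulEquiv_GGroup h1 (h'.comp (shear (-q))) ?_ ?_
    · filter_upwards [hp, hq] with n hpn hqn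
      change tx (ψ' n (shear (-q) genB)) = 0
      rw [shear_genB, tx_hom, hpn, hqn]
      simp
    · filter_upwards [hp] with n hpn
      change intMinpoly (l ^ tx (ψ' n (shear (-q) genA))) = _
      rw [shear_genA, hpn, zpow_one]
  · right
    refine nonempty_mulEquiv_MGroup h1 h' ?_ (fun g hg => ?_) fun Q => ⟨fun hQ => ?_, fun hQ => ?_⟩
    · filter_upwards [hp] with n hpn
      rw [hpn, zpow_one]
    · have h2 : ∀ᶠ n in (U : Filter ι), expA g + tx (ψ' n genB) * expB g = 0 := by
        filter_upwards [hp, hg] with n hpn hgn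
        rw [tx_hom, hpn, one_mul] at hgn
        exact hgn
      by_cases hB : expB g = 0
      · obtain ⟨n, hn⟩ := h2.exists
        rw [hB, mul_zero, add_zero] at hn
        exact ⟨hn, hB⟩
      · exfalso
        obtain ⟨m, hm⟩ := h2.exists
        -- The relation with `expB g ≠ 0` determines the exponent of `b`, which would then be
        -- constant.
        refine hconst ⟨tx (ψ' m genB), ?_⟩
        filter_upwards [h2] with n hn
        exact mul_right_cancel₀ hB (by linarith)
    · let S : Set ℤ := {q | ev l h0 1 q Q = 0}
      -- If `S` were finite, the ultrafilter would select one of its elements as the eventual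
      -- exponent of `b`.
      refine mem_idealOf_of_infinite (h0 := h0) hfin (S := S) (fun hS => hconst ?_) fun q hq => hq
      have h2 : ∀ᶠ n in (U : Filter ι), ∃ q ∈ S, tx (ψ' n genB) = q := by
        filter_upwards [hp, hQ] with n hpn hQn
        rw [hpn] at hQn
        exact ⟨_, hQn, rfl⟩
      obtain ⟨q, -, hq⟩ := (Ultrafilter.eventually_exists_mem_iff hS).1 h2
      exact ⟨q, hq⟩
    · filter_upwards [hp] with n hpn
      rw [hpn]
      exact ev_eq_zero_of_mem_idealOf h0 hfin _ hQ

theorem nonempty_mulEquiv_of_isLimit (h1 : l ≠ 1) (h : IsLimit U π ψ) {u : FreeMetab2}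
    (hu : ActsConj U ψ u) : Nonempty (G ≃* GGroup l h0) ∨ Nonempty (G ≃* MGroup l) := by
  by_cases hmid : ¬ IsOfFinOrder l ∧ IsAlgebraic ℤ l
  · exact nonempty_mulEquiv_of_not_isOfFinOrder h1 hmid.1 hmid.2 h hu
  · have hl : IsOfFinOrder l ∨ ¬ IsAlgebraic ℤ l := by tauto
    by_cases hne : ∀ g, (∀ᶠ n in (U : Filter ι), tx (ψ n g) = 0) → expA g = 0 ∧ expB g = 0
    · right
      rcases hl with hl | hl
      · exact nonempty_mulEquiv_MGroup_of_isOfFinOrder h1 hl h hu hne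
      · exact nonempty_mulEquiv_MGroup_of_not_isAlgebraic h1 hl h hne
    · left
      push Not at hne
      obtain ⟨g, hg1, hg2⟩ := hne
      exact nonempty_mulEquiv_GGroup_of_relation h1 hl h hu (fun h3 => hg2 h3.1 h3.2) hg1

end Limit

theorem nonempty_mulEquiv_of_universalTheory_eq {l : ℂ} (h0 : l ≠ 0) (h1 : l ≠ 1) {G : Type*}
    [Group G] (hG : IsTwoGenerated G) (hne : ∃ a b : G, a * b ≠ b * a)
    (hT : universalTheory G = universalTheory (GGroup l h0)) :
    Nonempty (G ≃* GGroup l h0) ∨ Nonempty (G ≃* MGroup l) := by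
  obtain ⟨a, b, hab⟩ := hG
  let ρ : FreeGroup (Fin 2) →* G := FreeGroup.lift ![a, b]
  have hρ : Function.Surjective ρ := by
    rw [← MonoidHom.range_eq_top, eq_top_iff, ← hab, Subgroup.closure_le]
    rintro g (rfl | rfl)
    · exact ⟨FreeGroup.of 0, by simp [ρ]⟩
    · exact ⟨FreeGroup.of 1, by simp [ρ]⟩
  obtain ⟨U, ψ, hψ⟩ := exists_limit_of_universalTheory_subset hT.ge ρ
  -- Being metabelian is inherited from the groups `G(l)` by their limit `G`.
  have hder : derivedSeries G 2 = ⊥ := by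
    rw [← map_derivedSeries_eq hρ, Subgroup.map_eq_bot_iff]
    intro w hw
    refine (hψ w).2 (Eventually.of_forall fun n => ?_)
    have := map_derivedSeries_le_derivedSeries (ψ n) 2 (Subgroup.mem_map_of_mem _ hw)
    rwa [derivedSeries_GGroup, Subgroup.mem_bot] at this
  have h : IsLimit U (metabLift hder ρ) (fun n => metabLift derivedSeries_GGroup (ψ n)) := by
    refine ⟨fun x => ?_, hne, fun g => ?_⟩
    · obtain ⟨w, rfl⟩ := hρ x
      exact ⟨QuotientGroup.mk w, rfl⟩
    · obtain ⟨w, rfl⟩ := QuotientGroup.mk_surjective g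
      exact hψ w
  obtain ⟨u, hu⟩ := exists_actsConj h1 h hT.le
  exact nonempty_mulEquiv_of_isLimit h1 h hu

/-! ### Chains of normal subgroups of the free metabelian group -/

theorem commPow_zsmul (k : ℤ) (P : Laurent2) : commPow (k • P) = commPow P ^ k :=
  map_zpow commPowHom (Multiplicative.ofAdd P) k

/-- The ideal of the Laurent polynomials `P` with `c ^ P` in a given normal subgroup. -/
def idealOfSubgroup (K : Subgroup FreeMetab2) (hK : K.Normal) : Ideal Laurent2 where
  carrier := {P | (commPow P : FreeMetab2) ∈ K}
  zero_mem' := by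
    change ((commPow 0 : commutator FreeMetab2) : FreeMetab2) ∈ K
    rw [commPow_zero]
    exact K.one_mem
  add_mem' {P Q} hP hQ := by
    change ((commPow (P + Q) : commutator FreeMetab2) : FreeMetab2) ∈ K
    rw [commPow_add]
    exact K.mul_mem hP hQ
  smul_mem' := by
    intro Q P hP
    change ((commPow (Q * P) : commutator FreeMetab2) : FreeMetab2) ∈ K
    induction Q using AddMonoidAlgebra.induction_linear with
    | zero =>
      rw [zero_mul, commPow_zero]
      exact K.one_mem
    | add Q R hQ hR =>
      rw [add_mul, commPow_add]
      exact K.mul_mem hQ hR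
    | single e n =>
      have h1 : (AddMonoidAlgebra.single e n * P : Laurent2) =
          n • (AddMonoidAlgebra.single e 1 * P) := by
        rw [← smul_mul_assoc, AddMonoidAlgebra.smul_single, smul_eq_mul, mul_one]
      have h2 := hK.conj_mem _ hP (genA ^ e.1 * genB ^ e.2)
      rw [conj_commPow] at h2
      simp only [expA_mul, expA_zpow, expA_genA, expA_genB, expB_mul, expB_zpow, expB_genA,
        expB_genB, mul_one, mul_zero, add_zero, zero_add] at h2
      rw [h1, commPow_zsmul]
      exact K.zpow_mem h2 n

/-- The exponents of the elements of a subgroup. -/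
def exponents (K : Subgroup FreeMetab2) : Submodule ℤ (ℤ × ℤ) :=
  AddSubgroup.toIntSubmodule
    { carrier := {v | ∃ g ∈ K, (expA g, expB g) = v}
      zero_mem' := ⟨1, K.one_mem, by simp⟩
      add_mem' := by
        rintro _ _ ⟨g, hg, rfl⟩ ⟨h, hh, rfl⟩
        exact ⟨g * h, K.mul_mem hg hh, by simp⟩
      neg_mem' := by
        rintro _ ⟨g, hg, rfl⟩
        exact ⟨g⁻¹, K.inv_mem hg, by simp⟩ }

/-- Nested normal subgroups coincide once their ideals in `ℤ[x^{±1}, y^{±1}]` and their exponent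
lattices in `ℤ²` do, and both of these satisfy the ascending chain condition. -/
theorem exists_eq_succ_of_monotone_normal (K : ℕ → Subgroup FreeMetab2) (hmono : Monotone K)
    (hN : ∀ n, (K n).Normal) : ∃ n, K (n + 1) ≤ K n := by
  have hL : IsNoetherianRing Laurent2 := Algebra.FiniteType.isNoetherianRing ℤ Laurent2
  obtain ⟨n₁, hn₁⟩ := monotone_stabilizes_iff_noetherian.2 hL
    ⟨fun n => idealOfSubgroup (K n) (hN n), fun m n hmn P hP => hmono hmn hP⟩
  obtain ⟨n₂, hn₂⟩ := monotone_stabilizes_iff_noetherian.2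
    (inferInstance : IsNoetherian ℤ (ℤ × ℤ))
    ⟨fun n => exponents (K n), by
      rintro m n hmn _ ⟨g, hg, rfl⟩
      exact ⟨g, hmono hmn hg, rfl⟩⟩
  let n := max n₁ n₂
  refine ⟨n, fun g hg => ?_⟩
  have hJ : idealOfSubgroup (K n) (hN n) = idealOfSubgroup (K (n + 1)) (hN (n + 1)) :=
    (hn₁ n (le_max_left _ _)).symm.trans (hn₁ (n + 1) ((le_max_left _ _).trans n.le_succ))
  have hE : exponents (K n) = exponents (K (n + 1)) :=
    (hn₂ n (le_max_right _ _)).symm.trans (hn₂ (n + 1) ((le_max_right _ _).trans n.le_succ))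
  have hgE : (expA g, expB g) ∈ exponents (K n) := by
    rw [hE]
    exact ⟨g, hg, rfl⟩
  obtain ⟨h, hh, hhg⟩ := hgE
  obtain ⟨P, hP⟩ := exists_commPow_eq (g := h⁻¹ * g) (mem_commutator_iff.2 (by
    have h1 := congrArg Prod.fst hhg
    have h2 := congrArg Prod.snd hhg
    dsimp only at h1 h2
    rw [expA_mul, expA_inv, expB_mul, expB_inv, h1, h2]
    simp))
  have hPJ : P ∈ idealOfSubgroup (K n) (hN n) := by
    rw [hJ]
    change (commPow P : FreeMetab2) ∈ K (n + 1)
    rw [hP]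
    exact (K (n + 1)).mul_mem ((K (n + 1)).inv_mem (hmono n.le_succ hh)) hg
  change (commPow P : FreeMetab2) ∈ K n at hPJ
  rw [hP] at hPJ
  exact (Subgroup.mul_mem_cancel_left _ ((K n).inv_mem hh)).1 hPJ

/-- Two-generated metabelian groups are Hopfian. -/
theorem injective_of_surjective_endomorphism {G : Type*} [Group G] {π : FreeMetab2 →* G}
    (hπ : Function.Surjective π) {f : G →* G} (hf : Function.Surjective f) :
    Function.Injective f := by
  let F : Monoid.End G := f
  have hpow : ∀ n g, (F ^ (n + 1)) g = f ((F ^ n) g) := fun n g => by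
    rw [pow_succ']; rfl
  -- The kernels of the iterates of `f` ascend, so two consecutive ones agree; surjectivity of `f^n`
  -- then transfers this to `ker f = 1`.
  obtain ⟨n, hn⟩ := exists_eq_succ_of_monotone_normal
    (fun n => (MonoidHom.comp (F ^ n : Monoid.End G) π).ker)
    (monotone_nat_of_le_succ fun n g hg => by
      have hg' : (F ^ n) (π g) = 1 := hg
      change (F ^ (n + 1)) (π g) = 1
      rw [hpow, hg', map_one])
    (fun n => inferInstance)
  have hsurj : Function.Surjective (F ^ n : Monoid.End G) := by
    rw [Monoid.End.coe_pow]
    exact hf.iterate n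
  refine (injective_iff_map_eq_one f).2 fun x hx => ?_
  obtain ⟨y, rfl⟩ := hsurj x
  obtain ⟨g, rfl⟩ := hπ y
  refine hn (x := g) ?_
  change (F ^ (n + 1)) (π g) = 1
  rw [hpow]
  exact hx

/-! ### The theorem -/

theorem exists_mul_ne_mul_of_universalTheory_subset {l : ℂ} {h0 : l ≠ 0} (h1 : l ≠ 1)
    {G : Type*} [Group G] (hT : universalTheory G ⊆ universalTheory (GGroup l h0)) :
    ∃ a b : G, a * b ≠ b * a := by
  by_contra hcon
  push Not at hcon
  let w : FreeGroup (Fin 2) := ⁅FreeGroup.of (0 : Fin 2), FreeGroup.of 1⁆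
  obtain ⟨ψ, hψ⟩ := exists_hom_of_universalTheory_subset hT
    (FreeGroup.lift ![genT l h0, genE l h0]) {w}
  have h2 := (hψ _ (Finset.mem_singleton_self _)).1 (by
    rw [map_commutatorElement, commutatorElement_eq_one_iff_mul_comm]
    exact hcon _ _)
  rw [map_commutatorElement, eq_one_iff_lc_tx, lc_commutator] at h2
  simp [sub_eq_zero, h1] at h2

theorem nonempty_mulEquiv_of_surjective_hom {l : ℂ} (h0 : l ≠ 0) (h1 : l ≠ 1) {Q : Type*}
    [Group Q] {f : FreeMetab2 →* Q} (hf : Function.Surjective f)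
    (hT : universalTheory Q = universalTheory (MGroup l)) :
    Nonempty (Q ≃* GGroup l h0) ∨ Nonempty (Q ≃* MGroup l) := by
  rw [universalTheory_MGroup h0 h1] at hT
  exact nonempty_mulEquiv_of_universalTheory_eq h0 h1 ⟨_, _, closure_map_pair hf⟩
    (exists_mul_ne_mul_of_universalTheory_subset h1 hT.le) hT

/-- If `Q₁` is `M(l)`, then `f` contradicts the Hopf property. If `Q₁` is `G(l)`, then `Q₂`, being
`G(l)` or `M(l)`, maps back onto `Q₁`, and the composite with `g` contradicts it. -/
theorem not_exists_chain_of_length_two {l : ℂ} (h0 : l ≠ 0) (h1 : l ≠ 1) {Q₀ Q₁ Q₂ : Type*}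
    [Group Q₀] [Group Q₁] [Group Q₂] (e : Q₀ ≃* MGroup l) (f : Q₀ →* Q₁) (g : Q₁ →* Q₂)
    (hT₁ : universalTheory Q₁ = universalTheory (MGroup l))
    (hT₂ : universalTheory Q₂ = universalTheory (MGroup l))
    (hf : Function.Surjective f) (hf' : ¬ Function.Injective f)
    (hg : Function.Surjective g) (hg' : ¬ Function.Injective g) : False := by
  have hs₁ : Function.Surjective ((f.comp e.symm.toMonoidHom).comp (projM l)) :=
    (hf.comp e.symm.surjective).comp (projM_surjective l)
  have hs₂ : Function.Surjective (g.comp ((f.comp e.symm.toMonoidHom).comp (projM l))) :=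
    hg.comp hs₁
  rcases nonempty_mulEquiv_of_surjective_hom h0 h1 hs₁ hT₁ with ⟨⟨e₁⟩⟩ | ⟨⟨e₁⟩⟩
  · apply hg'
    obtain ⟨k, hk⟩ : ∃ k : Q₂ →* Q₁, Function.Surjective k := by
      rcases nonempty_mulEquiv_of_surjective_hom h0 h1 hs₂ hT₂ with ⟨⟨e₂⟩⟩ | ⟨⟨e₂⟩⟩
      · exact ⟨(e₂.trans e₁.symm).toMonoidHom, (e₂.trans e₁.symm).surjective⟩
      · exact ⟨e₁.symm.toMonoidHom.comp ((phiM l h0 0).comp e₂.toMonoidHom),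
          e₁.symm.surjective.comp ((phiM_surjective 0).comp e₂.surjective)⟩
    have := injective_of_surjective_endomorphism hs₁ (f := k.comp g) (hk.comp hg)
    exact Function.Injective.of_comp this
  · apply hf'
    have := injective_of_surjective_endomorphism (projM_surjective l)
      (f := e₁.toMonoidHom.comp (f.comp e.symm.toMonoidHom))
      (e₁.surjective.comp (hf.comp e.symm.surjective))
    have h2 : Function.Injective (f.comp e.symm.toMonoidHom) := Function.Injective.of_comp this
    intro x y hxy
    exact e.injective (h2 (by simpa using hxy))

theorem hasQuotientChain_one {A B : Type u} [gA : Group A] [gB : Group B] (f : A →* B)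
    (hT : universalTheory B = universalTheory A) (hf : Function.Surjective f)
    (hf' : ¬ Function.Injective f) : HasQuotientChain A 1 := by
  let Q : Fin 2 → Type u := Fin.cons A fun _ => B
  let gQ : ∀ i, Group (Q i) := Fin.cons gA fun _ => gB
  refine ⟨Q, gQ, Fin.cons (α := fun i => Q i.castSucc →* Q i.succ) f fun j => j.elim0,
    ⟨MulEquiv.refl A⟩, ?_, ?_⟩
  · exact Fin.forall_fin_two.2 ⟨rfl, hT⟩
  · exact Fin.forall_fin_one.2 ⟨hf, hf'⟩

theorem hasKrullDim_MGroup {l : ℂ} (h0 : l ≠ 0) (h1 : l ≠ 1) : HasKrullDim (MGroup l) 1 := by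
  refine ⟨hasQuotientChain_one (phiM l h0 0) (universalTheory_MGroup h0 h1).symm
    (phiM_surjective 0) (not_injective_phiM_zero h1), ?_⟩
  rintro k ⟨Q, _, f, ⟨e⟩, hT, hf⟩
  by_contra hk
  let i : Fin k := ⟨0, by omega⟩
  let j : Fin k := ⟨1, by omega⟩
  have he : ∀ m, m = 0 → Nonempty (Q m ≃* MGroup l) := by
    rintro _ rfl
    exact ⟨e⟩
  obtain ⟨e'⟩ := he i.castSucc (Fin.ext (by simp [i]))
  -- The first two arrows compose because `j.castSucc` and `i.succ` are equal by definition.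
  exact not_exists_chain_of_length_two h0 h1 e' (f i) (f j : Q i.succ →* Q j.succ) (hT _) (hT _)
    (hf i).1 (hf i).2 (hf j).1 (hf j).2

end UnivTh

end

theorem mainTheorem6 (l : ℂ) (h0 : l ≠ 0) (h1 : l ≠ 1) :
    (∀ (G : Type*) [Group G], UnivTh.IsTwoGenerated G → (∃ a b : G, a * b ≠ b * a) →
      (UnivTh.universalTheory G = UnivTh.universalTheory (UnivTh.GGroup l h0) ↔
        Nonempty (G ≃* UnivTh.GGroup l h0) ∨ Nonempty (G ≃* UnivTh.MGroup l))) ∧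
    UnivTh.HasKrullDim (UnivTh.MGroup l) 1 := by
  refine ⟨fun G _ hG hne => ⟨UnivTh.nonempty_mulEquiv_of_universalTheory_eq h0 h1 hG hne, ?_⟩,
    UnivTh.hasKrullDim_MGroup h0 h1⟩
  rintro (⟨⟨e⟩⟩ | ⟨⟨e⟩⟩)
  · exact UnivTh.universalTheory_congr e
  · exact (UnivTh.universalTheory_congr e).trans (UnivTh.universalTheory_MGroup h0 h1)
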